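/- \textbf{Corollary (component-by-component bound for symmetrized lattice rules).} Let $s \ge 1$, $\alpha > 1/2$, $\boldsymbol\gamma = (\gamma_1,\dots,\gamma_s) \in (0,\infty)^s$ and let $N \ge 2$ be an integer. Put $r_{\alpha,\gamma}(0) = 1$, $r_{\alpha,\gamma}(h) = \gamma |h|^{-2\alpha}$ for $h \in \mathbb{Z}\setminus\{0\}$, and for $x,y \in [0,1]$ $$K^{\rm kor}_{\alpha,\gamma}(x,y) = \sum_{h \in \mathbb{Z}} r_{\alpha,\gamma}(h)\, e^{2\pi i h (x-y)}, \qquad K^{\cos}_{\alpha,\gamma}(x,y) = 1 + \sum_{k=1}^\infty r_{\alpha,\gamma}(k)\, \sqrt2\cos(\pi k x)\, \sqrt2 \cos(\pi k y).$$ For $1 \le d \le s$ and $\boldsymbol x, \boldsymbol y \in [0,1]^d$ let $K^{\rm kor}_{\alpha,\boldsymbol\gamma,d}(\boldsymbol x,\boldsymbol y) = \prod_{j=1}^d K^{\rm kor}_{\alpha,\gamma_j}(x_j,y_j)$ and $K^{{\rm kor}+\cos}_{\alpha,\boldsymbol\gamma,d}(\boldsymbol x,\boldsymbol y) = \prod_{j=1}^d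 \tfrac12\big(K^{\rm kor}_{\alpha,\gamma_j}(x_j,y_j) + K^{\cos}_{\alpha,\gamma_j}(x_j,y_j)\big)$, and let $\mathcal H(K)$ be the reproducing kernel Hilbert space of real functions on $[0,1]^d$ with kernel $K$. For a finite family $P=(\boldsymbol p_i)_{i \in \iota}$ of points of $[0,1]^d$ (counted with multiplicity) let $$e(\mathcal H(K);P) = \sup_{\|f\|_K \le 1} \Big| \int_{[0,1]^d} f(\boldsymbol x)\,d\boldsymbol x - \frac{1}{|\iota|} \sum_{i \in \iota} f(\boldsymbol p_i) \Big|.$$ For $\boldsymbol g \in \{1,\dots,N-1\}^d$ let $P(\boldsymbol g,N)$ consist of the points $\{n \boldsymbol g/N\}$, $0 \le n < N$ (componentwise fractional parts), and let $P_{\rm sym}(\boldsymbol g,N)$ consist of the $2^d N$ points $\operatorname{sym}_{\mathfrak u}(\{n\boldsymbol g/N\})$, $0 \le n < N$, $\mathfrak u \subseteq \{1,\dots,d\}$, where $\operatorname{sym}_{\mathfrak u}$ replaces $x_j$ by $1-x_j$ for each $j \in \mathfrak u$. Construct $\boldsymbol g = (g_1,\dots,g_s) \in \{1,\dots,N-1\}^s$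 component by component: for $d = 1,\dots,s$, with $g_1,\dots,g_{d-1}$ kept fixed, let $g_d$ be a minimizer over $\{1,\dots,N-1\}$ of the error in dimension $d$. The error may be either $e(\mathcal H(K^{\rm kor}_{\alpha,\boldsymbol\gamma,d}); P((g_1,\dots,g_d),N))$ or $e(\mathcal H(K^{{\rm kor}+\cos}_{\alpha,\boldsymbol\gamma,d}); P_{\rm sym}((g_1,\dots,g_d),N))$ (the same one in all steps). Then such vectors $\boldsymbol g$ exist for both choices, and every such $\boldsymbol g$ satisfies $$e\big(\mathcal H(K^{{\rm kor}+\cos}_{\alpha,\boldsymbol\gamma,s}); P_{\rm sym}(\boldsymbol g,N)\big) \le C_{\alpha,\boldsymbol\gamma,s,\tau}\, (N-1)^{-\tau/2} \qquad \text{for all } 1 \le \tau < 2\alpha,$$ where, with $\gamma_{\mathfrak u} = \prod_{j \in \mathfrak u} \gamma_j$, the constant $C_{\alpha,\boldsymbol\gamma,s,\tau} > 0$ is $$C_{\alpha,\boldsymbol\gamma,s,\tau} = \Big( \sum_{\emptyset \ne \mathfrak u \subseteq \{1,\dots,s\}} \gamma_{\mathfrak u}^{1/\tau} \big(2\zeta(2\alpha/\tau)\big)^{|\mathfrak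 u|} \Big)^{\tau/2} = \Big( -1 + \prod_{j=1}^s \big( 1 + 2\zeta(2\alpha/\tau)\, \gamma_j^{1/\tau} \big) \Big)^{\tau/2}.$$ -/

import Mathlib

open MeasureTheory
open scoped ENNReal unitInterval

noncomputable section

namespace LatticeCubature

/-! ### Kernels and their reproducing kernel Hilbert spaces -/

/-- A scalar kernel `K` on `X`, written as a matrix of operators on `ℝ` (multiplication by
`K x y`), which is the form in which Mathlib builds the reproducing kernel Hilbert space. -/
def kernelMatrix {X : Type*} (K : X → X → ℝ) : Matrix X X (ℝ →L[ℝ] ℝ) :=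
  Matrix.of fun x y => K x y • ContinuousLinearMap.id ℝ ℝ

/-- The real kernel `K` is symmetric and positive semidefinite. -/
def IsPSDKernel {X : Type*} (K : X → X → ℝ) : Prop :=
  (∀ x y, K x y = K y x) ∧
    ∀ c : X →₀ ℝ, 0 ≤ c.sum fun x a => c.sum fun y b => a * b * K x y

theorem IsPSDKernel.kernelMatrix_posSemidef {X : Type*} {K : X → X → ℝ} (hK : IsPSDKernel K) :
    (kernelMatrix K).PosSemidef := by
  have htfae := (RKHS.posSemidef_tfae (𝕜 := ℝ) (K := kernelMatrix K)).out 0 2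
  refine htfae.mpr ⟨?_, fun c => ?_⟩
  · ext x y
    have h1 : star (ContinuousLinearMap.id ℝ ℝ) = ContinuousLinearMap.id ℝ ℝ :=
      star_one (ℝ →L[ℝ] ℝ)
    simp [kernelMatrix, Matrix.conjTranspose_apply, hK.1 x y, h1]
  · have h := hK.2 c
    have key : ∀ x y a b, inner ℝ ((kernelMatrix K) x y a) b = a * b * K x y := by
      intro x y a b
      simp [kernelMatrix, mul_comm, mul_left_comm]
    simp only [key, RCLike.re_to_real]
    refine h.trans_eq (Finset.sum_congr rfl fun x _ => Finset.sum_congr rfl fun y _ => ?_)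
    simp only [hK.1 x y]

theorem IsPSDKernel.rankOne {X : Type*} (φ : X → ℝ) : IsPSDKernel fun x y => φ x * φ y := by
  refine ⟨fun x y => mul_comm _ _, fun c => ?_⟩
  have : (c.sum fun x a => c.sum fun y b => a * b * (φ x * φ y))
      = (c.sum fun x a => a * φ x) ^ 2 := by
    simp only [Finsupp.sum, sq, Finset.sum_mul_sum]
    refine Finset.sum_congr rfl fun x _ => Finset.sum_congr rfl fun y _ => by ring
  rw [this]
  positivity

theorem IsPSDKernel.one {X : Type*} : IsPSDKernel fun _ _ : X => (1 : ℝ) := by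
  simpa using IsPSDKernel.rankOne (X := X) fun _ => 1

theorem IsPSDKernel.add {X : Type*} {K L : X → X → ℝ} (hK : IsPSDKernel K)
    (hL : IsPSDKernel L) : IsPSDKernel fun x y => K x y + L x y := by
  refine ⟨fun x y => congrArg₂ (· + ·) (hK.1 x y) (hL.1 x y), fun c => ?_⟩
  have := add_nonneg (hK.2 c) (hL.2 c)
  simpa only [mul_add, Finsupp.sum, Finset.sum_add_distrib] using this

theorem IsPSDKernel.const_mul {X : Type*} {K : X → X → ℝ} (hK : IsPSDKernel K) {t : ℝ}
    (ht : 0 ≤ t) : IsPSDKernel fun x y => t * K x y := by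
  refine ⟨fun x y => congrArg (t * ·) (hK.1 x y), fun c => ?_⟩
  have := mul_nonneg ht (hK.2 c)
  simp only [Finsupp.sum, Finset.mul_sum] at this ⊢
  refine this.trans_eq (Finset.sum_congr rfl fun x _ => Finset.sum_congr rfl fun y _ => ?_)
  ring

theorem IsPSDKernel.tsum {X ι : Type*} {F : ι → X → X → ℝ} (hF : ∀ i, IsPSDKernel (F i))
    (hs : ∀ x y, Summable fun i => F i x y) : IsPSDKernel fun x y => ∑' i, F i x y := by
  refine ⟨fun x y => tsum_congr fun i => (hF i).1 x y, fun c => ?_⟩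
  have h : HasSum (fun i => c.sum fun x a => c.sum fun y b => a * b * F i x y)
      (c.sum fun x a => c.sum fun y b => a * b * ∑' i, F i x y) := by
    simp only [Finsupp.sum]
    exact hasSum_sum fun x _ => hasSum_sum fun y _ => (hs x y).hasSum.mul_left _
  exact h.nonneg fun i => (hF i).2 c

theorem IsPSDKernel.comp {X Y : Type*} {K : X → X → ℝ} (hK : IsPSDKernel K) (p : Y → X) :
    IsPSDKernel fun x y => K (p x) (p y) := by
  classical
  refine ⟨fun x y => hK.1 _ _, fun c => ?_⟩
  have := hK.2 (c.mapDomain p)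
  rw [Finsupp.sum_mapDomain_index (by simp)
    (by intros; simp only [Finsupp.sum, add_mul, Finset.sum_add_distrib])] at this
  refine this.trans_eq (Finsupp.sum_congr fun x _ => ?_)
  rw [Finsupp.sum_mapDomain_index (by simp) (by intros; ring)]

theorem IsPSDKernel.mul {X : Type*} {K L : X → X → ℝ} (hK : IsPSDKernel K)
    (hL : IsPSDKernel L) : IsPSDKernel fun x y => K x y * L x y := by
  have conv : ∀ {M : X → X → ℝ}, IsPSDKernel M ↔ (Matrix.of M).PosSemidef := by
    intro M
    constructor
    · intro h
      refine ⟨?_, fun c => ?_⟩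
      · ext x y
        simp [Matrix.conjTranspose_apply, h.1 x y]
      · refine (h.2 c).trans_eq (Finset.sum_congr rfl fun x _ => Finset.sum_congr rfl fun y _ => ?_)
        simp only [star_trivial, Matrix.of_apply]
        ring
    · intro h
      refine ⟨fun x y => ?_, fun c => ?_⟩
      · have := h.1.apply x y
        simpa using this.symm
      · refine (h.2 c).trans_eq (Finset.sum_congr rfl fun x _ => Finset.sum_congr rfl fun y _ => ?_)
        simp only [star_trivial, Matrix.of_apply]
        ring
  have := (conv.1 hK).hadamard (conv.1 hL)
  exact conv.2 this

theorem IsPSDKernel.prod {X : Type*} {d : ℕ} {K : Fin d → X → X → ℝ}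
    (hK : ∀ j, IsPSDKernel (K j)) : IsPSDKernel fun x y => ∏ j, K j x y := by
  induction d with
  | zero => simpa using IsPSDKernel.one
  | succ d ih =>
    simp only [Fin.prod_univ_succ]
    exact (hK 0).mul (ih fun j => hK j.succ)

/-- The space `H(K)`: the reproducing kernel Hilbert space of real functions on `X` whose
reproducing kernel is the positive semidefinite kernel `K`. -/
abbrev KernelSpace {X : Type*} (K : X → X → ℝ) [Fact (kernelMatrix K).PosSemidef] : Type _ :=
  RKHS.OfKernel (kernelMatrix K)

/-- The worst-case error of the equal-weight cubature rule with the nodes `p i` (counted with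
multiplicity, `i ∈ ι`) over the unit ball of a reproducing kernel Hilbert space `H` of real
functions on `[0,1]^d`. -/
def worstCaseError (H : Type*) {d : ℕ} [NormedAddCommGroup H] [InnerProductSpace ℝ H]
    [RKHS ℝ H (Fin d → I) ℝ] {ι : Type*} [Fintype ι] (p : ι → Fin d → I) : ℝ≥0∞ :=
  ⨆ (f : H) (_ : ‖f‖ ≤ 1),
    ENNReal.ofReal |(∫ x : Fin d → I, f x) - (1 / (Fintype.card ι : ℝ)) * ∑ i, f (p i)|

/-! ### The Korobov kernel, the half-period cosine kernel, and their sum -/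

/-- `r_{α,γ}(h)`, equal to `1` for `h = 0` and to `γ |h|^{-2α}` otherwise. -/
def decay (α γ : ℝ) (h : ℤ) : ℝ :=
  if h = 0 then 1 else γ * |(h : ℝ)| ^ (-2 * α)

/-- The one-dimensional Korobov kernel `∑_{h ∈ ℤ} r_{α,γ}(h) e^{2πih(x-y)}`. The series is
invariant under conjugation, so its sum is real. -/
def korobovKernel₁ (α γ : ℝ) (x y : I) : ℝ :=
  (∑' h : ℤ, (decay α γ h : ℂ) *
    Complex.exp (2 * Real.pi * Complex.I * h * (((x : ℝ) : ℂ) - ((y : ℝ) : ℂ)))).re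

/-- The one-dimensional half-period cosine kernel
`1 + ∑_{k ≥ 1} r_{α,γ}(k) √2 cos(πkx) √2 cos(πky)`. -/
def cosineKernel₁ (α γ : ℝ) (x y : I) : ℝ :=
  1 + ∑' k : ℕ, decay α γ ((k : ℤ) + 1) *
    (√2 * Real.cos (Real.pi * ((k : ℝ) + 1) * x)) * (√2 * Real.cos (Real.pi * ((k : ℝ) + 1) * y))

/-- The kernel of the Korobov space on `[0,1]^d` with weights `γ`. -/
def korobovKernel (α : ℝ) {d : ℕ} (γ : Fin d → ℝ) (x y : Fin d → I) : ℝ :=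
  ∏ j, korobovKernel₁ α (γ j) (x j) (y j)

/-- The kernel of the sum of the Korobov and the half-period cosine space on `[0,1]^d`. -/
def korCosKernel (α : ℝ) {d : ℕ} (γ : Fin d → ℝ) (x y : Fin d → I) : ℝ :=
  ∏ j, (1 / 2) * (korobovKernel₁ α (γ j) (x j) (y j) + cosineKernel₁ α (γ j) (x j) (y j))

theorem decay_nonneg (α : ℝ) {γ : ℝ} (hγ : 0 < γ) (h : ℤ) : 0 ≤ decay α γ h := by
  unfold decay
  split_ifs <;> positivity

theorem summable_decay {α : ℝ} (hα : 1 / 2 < α) (γ : ℝ) : Summable (decay α γ) := by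
  have h : Summable fun n : ℤ => γ * |(n : ℝ)| ^ (-2 * α) := by
    have := (Real.summable_abs_int_rpow (b := 2 * α) (by linarith)).mul_left γ
    simpa [neg_mul] using this
  refine (summable_congr_cofinite ?_).mp h
  filter_upwards [(Set.finite_singleton (0 : ℤ)).compl_mem_cofinite] with n hn
  simp [decay, show n ≠ 0 from hn]

theorem korobovKernel₁_eq {α : ℝ} (hα : 1 / 2 < α) {γ : ℝ} (hγ : 0 < γ) (x y : I) :
    Summable (fun h : ℤ => decay α γ h *
        (Real.cos (2 * Real.pi * h * x) * Real.cos (2 * Real.pi * h * y)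
          + Real.sin (2 * Real.pi * h * x) * Real.sin (2 * Real.pi * h * y))) ∧
      korobovKernel₁ α γ x y = ∑' h : ℤ, decay α γ h *
        (Real.cos (2 * Real.pi * h * x) * Real.cos (2 * Real.pi * h * y)
          + Real.sin (2 * Real.pi * h * x) * Real.sin (2 * Real.pi * h * y)) := by
  have e : ∀ h : ℤ, 2 * (Real.pi : ℂ) * Complex.I * h * (((x : ℝ) : ℂ) - ((y : ℝ) : ℂ))
      = ((2 * Real.pi * h * x - 2 * Real.pi * h * y : ℝ) : ℂ) * Complex.I := by
    intro h
    push_cast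
    ring
  have hs : Summable fun h : ℤ => (decay α γ h : ℂ) *
      Complex.exp (2 * Real.pi * Complex.I * h * (((x : ℝ) : ℂ) - ((y : ℝ) : ℂ))) := by
    refine Summable.of_norm ((summable_decay hα γ).congr fun h => ?_)
    rw [norm_mul, e, Complex.norm_exp_ofReal_mul_I, mul_one, Complex.norm_real,
      Real.norm_of_nonneg (decay_nonneg α hγ h)]
  have hre : ∀ h : ℤ, ((decay α γ h : ℂ) *
      Complex.exp (2 * Real.pi * Complex.I * h * (((x : ℝ) : ℂ) - ((y : ℝ) : ℂ)))).re
      = decay α γ h * (Real.cos (2 * Real.pi * h * x) * Real.cos (2 * Real.pi * h * y)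
          + Real.sin (2 * Real.pi * h * x) * Real.sin (2 * Real.pi * h * y)) := by
    intro h
    rw [e, Complex.re_ofReal_mul, Complex.exp_ofReal_mul_I_re, Real.cos_sub]
  have hsum := Complex.hasSum_re hs.hasSum
  simp only [hre] at hsum
  exact ⟨hsum.summable, hsum.tsum_eq.symm⟩

theorem isPSDKernel_korobovKernel₁ {α : ℝ} (hα : 1 / 2 < α) {γ : ℝ} (hγ : 0 < γ) :
    IsPSDKernel (korobovKernel₁ α γ) := by
  have := IsPSDKernel.tsum (fun h : ℤ => ((IsPSDKernel.rankOne fun x : I =>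
    Real.cos (2 * Real.pi * h * x)).add (IsPSDKernel.rankOne fun x : I =>
    Real.sin (2 * Real.pi * h * x))).const_mul (decay_nonneg α hγ h))
    fun x y => (korobovKernel₁_eq hα hγ x y).1
  convert this using 1
  funext x y
  exact (korobovKernel₁_eq hα hγ x y).2

theorem isPSDKernel_cosineKernel₁ {α : ℝ} (hα : 1 / 2 < α) {γ : ℝ} (hγ : 0 < γ) :
    IsPSDKernel (cosineKernel₁ α γ) := by
  refine IsPSDKernel.one.add ?_
  have hinj : Function.Injective fun k : ℕ => (k : ℤ) + 1 := fun a b h => by simpa using h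
  have hs : Summable fun k : ℕ => decay α γ ((k : ℤ) + 1) := (summable_decay hα γ).comp_injective hinj
  refine IsPSDKernel.tsum (fun k => ?_) fun x y => ?_
  · have := (IsPSDKernel.rankOne fun x : I =>
      √2 * Real.cos (Real.pi * ((k : ℝ) + 1) * x)).const_mul (decay_nonneg α hγ ((k : ℤ) + 1))
    simpa only [mul_assoc] using this
  · refine Summable.of_norm_bounded (hs.mul_right 2) fun k => ?_
    have h0 := decay_nonneg α hγ ((k : ℤ) + 1)
    have h2 : √2 * √2 = (2 : ℝ) := Real.mul_self_sqrt (by norm_num)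
    have e : decay α γ ((k : ℤ) + 1) * (√2 * Real.cos (Real.pi * ((k : ℝ) + 1) * x)) *
        (√2 * Real.cos (Real.pi * ((k : ℝ) + 1) * y)) = decay α γ ((k : ℤ) + 1) * (√2 * √2) *
        (Real.cos (Real.pi * ((k : ℝ) + 1) * x) * Real.cos (Real.pi * ((k : ℝ) + 1) * y)) := by
      ring
    have h3 : 0 ≤ decay α γ ((k : ℤ) + 1) * 2 := by positivity
    rw [e, h2, norm_mul, Real.norm_of_nonneg h3]
    refine mul_le_of_le_one_right h3 ?_
    rw [norm_mul]
    exact mul_le_one₀ (Real.abs_cos_le_one _) (norm_nonneg _) (Real.abs_cos_le_one _)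

theorem posSemidef_korobovKernel {α : ℝ} (hα : 1 / 2 < α) {d : ℕ} {γ : Fin d → ℝ}
    (hγ : ∀ j, 0 < γ j) : (kernelMatrix (korobovKernel α γ)).PosSemidef :=
  (IsPSDKernel.prod fun j => (isPSDKernel_korobovKernel₁ hα (hγ j)).comp
    fun x : Fin d → I => x j).kernelMatrix_posSemidef

theorem posSemidef_korCosKernel {α : ℝ} (hα : 1 / 2 < α) {d : ℕ} {γ : Fin d → ℝ}
    (hγ : ∀ j, 0 < γ j) : (kernelMatrix (korCosKernel α γ)).PosSemidef :=
  (IsPSDKernel.prod fun j => (((isPSDKernel_korobovKernel₁ hα (hγ j)).add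
    (isPSDKernel_cosineKernel₁ hα (hγ j))).const_mul (by norm_num : (0 : ℝ) ≤ 1 / 2)).comp
    fun x : Fin d → I => x j).kernelMatrix_posSemidef

/-- Admissible smoothness and weights: `α > 1/2` and `γ ∈ (0,∞)^d`. -/
structure Admissible (α : ℝ) {d : ℕ} (γ : Fin d → ℝ) : Prop where
  half_lt : 1 / 2 < α
  weight_pos : ∀ j, 0 < γ j

instance instFactKorobov {α : ℝ} {d : ℕ} {γ : Fin d → ℝ} [h : Fact (Admissible α γ)] :
    Fact (kernelMatrix (korobovKernel α γ)).PosSemidef :=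
  ⟨posSemidef_korobovKernel h.out.half_lt h.out.weight_pos⟩

instance instFactKorCos {α : ℝ} {d : ℕ} {γ : Fin d → ℝ} [h : Fact (Admissible α γ)] :
    Fact (kernelMatrix (korCosKernel α γ)).PosSemidef :=
  ⟨posSemidef_korCosKernel h.out.half_lt h.out.weight_pos⟩

/-- The weights of the first `d` coordinates. -/
abbrev firstWeights {s d : ℕ} (γ : Fin s → ℝ) (hd : d ≤ s) : Fin d → ℝ :=
  fun j => γ (Fin.castLE hd j)

instance instFactFirstWeights {α : ℝ} {s d : ℕ} {γ : Fin s → ℝ} [h : Fact (Admissible α γ)]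
    {hd : d ≤ s} : Fact (Admissible α (firstWeights γ hd)) :=
  ⟨⟨h.out.half_lt, fun j => h.out.weight_pos (Fin.castLE hd j)⟩⟩

/-- The Korobov space on `[0,1]^d`. -/
abbrev KorobovSpace (α : ℝ) {d : ℕ} (γ : Fin d → ℝ) [Fact (Admissible α γ)] : Type :=
  KernelSpace (korobovKernel α γ)

/-- The sum of the Korobov space and the half-period cosine space on `[0,1]^d`. -/
abbrev KorCosSpace (α : ℝ) {d : ℕ} (γ : Fin d → ℝ) [Fact (Admissible α γ)] : Type :=
  KernelSpace (korCosKernel α γ)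

/-! ### Lattice rules and symmetrized lattice rules -/

/-- The lattice points `{n g / N}`, `0 ≤ n < N`. -/
def latticePoint {d : ℕ} (N : ℕ) (g : Fin d → ℕ) (n : Fin N) : Fin d → I :=
  fun j => ⟨Int.fract ((n : ℝ) * g j / N), Int.fract_nonneg _, (Int.fract_lt_one _).le⟩

/-- `sym_u(x)`: the coordinates in `u` are reflected by `t ↦ 1 - t`. -/
def symPoint {d : ℕ} (u : Finset (Fin d)) (x : Fin d → I) : Fin d → I :=
  fun j => if j ∈ u then unitInterval.symm (x j) else x j

/-- The nodes `sym_u({n g / N})`, `0 ≤ n < N`, `u ⊆ [d]`, of the symmetrized lattice rule; all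
`2^d N` of them are counted. -/
def symLatticePoint {d : ℕ} (N : ℕ) (g : Fin d → ℕ) (i : Fin N × Finset (Fin d)) : Fin d → I :=
  symPoint i.2 (latticePoint N g i.1)

/-! ### The component-by-component construction -/

/-- `g ∈ {1, …, N-1}^s` is an output of the component-by-component construction for the error
criterion `err`: for each `d < s`, with the first `d` components kept fixed, the next component
minimizes the `(d+1)`-dimensional criterion over `{1, …, N-1}`. -/
def IsCBCVector (N s : ℕ) (err : (d : ℕ) → d ≤ s → (Fin d → ℕ) → ℝ≥0∞) (g : Fin s → ℕ) : Prop :=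
  (∀ j, g j ∈ Finset.Icc 1 (N - 1)) ∧
    ∀ (d : ℕ) (hd : d + 1 ≤ s), ∀ z ∈ Finset.Icc 1 (N - 1),
      err (d + 1) hd (fun i => g (Fin.castLE hd i)) ≤
        err (d + 1) hd
          (Fin.snoc (α := fun _ => ℕ) (fun i : Fin d => g (Fin.castLE (Nat.le_of_succ_le hd) i)) z)

/-- The criterion `e(H(K^kor); P(g,N))` in dimension `d`. -/
def korobovCriterion (α : ℝ) {s : ℕ} (γ : Fin s → ℝ) [Fact (Admissible α γ)] (N : ℕ)
    (d : ℕ) (hd : d ≤ s) (g : Fin d → ℕ) : ℝ≥0∞ :=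
  worstCaseError (KorobovSpace α (firstWeights γ hd)) (latticePoint N g)

/-- The criterion `e(H(K^{kor+cos}); P_sym(g,N))` in dimension `d`. -/
def korCosCriterion (α : ℝ) {s : ℕ} (γ : Fin s → ℝ) [Fact (Admissible α γ)] (N : ℕ)
    (d : ℕ) (hd : d ≤ s) (g : Fin d → ℕ) : ℝ≥0∞ :=
  worstCaseError (KorCosSpace α (firstWeights γ hd)) (symLatticePoint N g)

/-- The real number `ζ(t)`, used for `t > 1`. -/
def realZeta (t : ℝ) : ℝ := (riemannZeta (t : ℂ)).re

/-- `C_{α,γ,s,τ} = (∑_{∅ ≠ u ⊆ [s]} γ_u^{1/τ} (2 ζ(2α/τ))^{|u|})^{τ/2}`, `γ_u = ∏_{j ∈ u} γ_j`. -/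
def cbcConstant (α : ℝ) {s : ℕ} (γ : Fin s → ℝ) (τ : ℝ) : ℝ :=
  (∑ u : Finset (Fin s) with u.Nonempty,
    (∏ j ∈ u, γ j) ^ (1 / τ) * (2 * realZeta (2 * α / τ)) ^ u.card) ^ (τ / 2)

end LatticeCubature

end

noncomputable section

namespace LatticeCubature

/-! ### Worst-case error as a double sum of the kernel -/

section RKHSError

variable {H : Type*} {d : ℕ} [NormedAddCommGroup H] [InnerProductSpace ℝ H] [CompleteSpace H]
  [RKHS ℝ H (Fin d → I) ℝ] {K : (Fin d → I) → (Fin d → I) → ℝ}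

/-! Both kernels are continuous and integrate to `1` in one variable, so the Riesz representer of
the cubature error gives `e² = -1 + (mean of K over pairs of nodes)` (`worstCaseError_eq`). At
lattice points only frequencies modulo `N` matter. Folding the Fourier decay onto `ℤ/N` turns the
Korobov mean into `dualSum`, the sum of `∏ R_j(h_j)` over the `h` with `∑ h_j g_j = 0`. For the sum
space, averaging over reflections kills the sines and the odd cosines. What remains has only the
frequencies `cos (2π h x)`, with weight `symWeight α γ ≤ γ`, and its mean is `symDualSum`, where the
indicator of the dual lattice is replaced by `cosMean ^ 2`. Since `0 ≤ cosMean ≤ 1`, and since the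
even weights cannot distinguish `cosMean` from the indicator, `symDualSum ≤ dualSum`
(`symDualSum_le_dualSum`).

Adding a coordinate splits either sum into its previous value, from the zero frequency of the new
coordinate, and a nonnegative increment depending on the new generator `z`. Since `1/τ ≤ 1`, the map
`x ↦ x^(1/τ)` is subadditive, so the power of the increment is at most the increment for the powered
weights, which decay like `|h|^(-2α/τ)` and are summable because `τ < 2α`. It therefore suffices to
find one nonzero `z` whose powered increment is at most its total mass over `N - 1`
(`exists_dualSum_snoc_le`). A minimizer does no worse than this `z`, and the product bound follows
by induction on the dimension (`dual_bound_of_minimizer`).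

The good `z` comes from an average. To get the factor `1/(N-1)` for composite `N` as well, the
average over `z` is taken with Möbius weights `Q`. They are nonnegative by an Euler product
(`moebiusWeight_nonneg`), and Möbius inversion gives `∑ Q(g) ∑ h^(-t) W(hg) = ∑ W` for every `W`
(`sum_moebiusWeight_mul_tsum`). Testing this identity on two choices of `W` shows that the mass of
`Q` off zero is at least `(N-1)/ζ(t)` (`exists_ne_zero_tsum_le`). -/

theorem inner_kerFun_kerFun (hK : RKHS.kernel H = kernelMatrix K) (x y : Fin d → I) :
    inner ℝ (RKHS.kerFun H x (1 : ℝ)) (RKHS.kerFun H y (1 : ℝ)) = K x y := by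
  rw [RKHS.kerFun_inner, RKHS.kerFun_apply, hK]
  simp [kernelMatrix]

/-- The squared distance of two kernel sections is `K y y - 2 K y x + K x x`, so continuity of `K`
passes to the feature map. This makes the Bochner integral of the feature map available. -/
theorem continuous_kerFun_one (hK : RKHS.kernel H = kernelMatrix K)
    (hc : Continuous fun p : (Fin d → I) × (Fin d → I) => K p.1 p.2) :
    Continuous fun x => RKHS.kerFun H x (1 : ℝ) := by
  rw [continuous_iff_continuousAt]
  intro x
  rw [ContinuousAt, tendsto_iff_norm_sub_tendsto_zero]
  have h : ∀ y, ‖RKHS.kerFun H y (1 : ℝ) - RKHS.kerFun H x (1 : ℝ)‖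
      = √(K y y - 2 * K y x + K x x) := by
    intro y
    rw [← inner_kerFun_kerFun hK, ← inner_kerFun_kerFun hK, ← inner_kerFun_kerFun hK,
      real_inner_self_eq_norm_sq, real_inner_self_eq_norm_sq, ← norm_sub_sq_real,
      Real.sqrt_sq (norm_nonneg _)]
  simp only [h]
  have hcont : Continuous fun y => √(K y y - 2 * K y x + K x x) := by
    have h1 : Continuous fun y => K y y := hc.comp (continuous_id.prodMk continuous_id)
    have h2 : Continuous fun y => K y x := hc.comp (continuous_id.prodMk continuous_const)
    fun_prop
  have := hcont.tendsto x
  rwa [show K x x - 2 * K x x + K x x = 0 by ring, Real.sqrt_zero] at this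

theorem integrable_kerFun_one (hK : RKHS.kernel H = kernelMatrix K)
    (hc : Continuous fun p : (Fin d → I) × (Fin d → I) => K p.1 p.2) :
    Integrable fun x => RKHS.kerFun H x (1 : ℝ) :=
  (continuous_kerFun_one hK hc).integrable_of_hasCompactSupport
    (HasCompactSupport.of_compactSpace _)

theorem integrable_coe (hK : RKHS.kernel H = kernelMatrix K)
    (hc : Continuous fun p : (Fin d → I) × (Fin d → I) => K p.1 p.2) (f : H) :
    Integrable fun x => f x := by
  have := (integrable_kerFun_one hK hc).const_inner (𝕜 := ℝ) f
  simpa using this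

/-- The error functional is represented by `ξ`, the mean of the kernel sections over the cube minus
their mean over the nodes, so the supremum is `‖ξ‖`. In `‖ξ‖²` every product involving the integral
mean equals `1`, which leaves `1 - 2 + (double sum)`. -/
theorem worstCaseError_eq (hK : RKHS.kernel H = kernelMatrix K)
    (hc : Continuous fun p : (Fin d → I) × (Fin d → I) => K p.1 p.2)
    (h1 : ∀ y, ∫ x, K x y = 1) {ι : Type*} [Fintype ι] [Nonempty ι] (p : ι → Fin d → I) :
    worstCaseError H p = ENNReal.ofReal
      √(-1 + (1 / (Fintype.card ι : ℝ)) ^ 2 * ∑ i, ∑ j, K (p i) (p j)) := by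
  set k : (Fin d → I) → H := fun x => RKHS.kerFun H x (1 : ℝ) with hk
  have hint : Integrable k := integrable_kerFun_one hK hc
  set m : H := ∫ x, k x with hm
  set c : ℝ := 1 / (Fintype.card ι : ℝ) with hcdef
  set ξ : H := m - c • ∑ i, k (p i) with hξ
  have hkk : ∀ x y, inner ℝ (k x) (k y) = K x y := inner_kerFun_kerFun hK
  have hm' : ∀ f : H, inner ℝ m f = ∫ x, f x := by
    intro f
    rw [real_inner_comm, hm, ← integral_inner hint]
    simp [hk]
  have hmk : ∀ y, inner ℝ m (k y) = 1 := by
    intro y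
    rw [hm', ← h1 y]
    refine integral_congr_ae (Filter.Eventually.of_forall fun x => ?_)
    simp only [← hkk, hk, RKHS.kerFun_inner]
    simp
  -- As a function, `m` is the constant `1`, and pairing with `m` is integration.
  have hmm : inner ℝ m m = (1 : ℝ) := by
    have hx : ∀ x, m x = 1 := by
      intro x
      have := hmk x
      rw [hk, RKHS.inner_kerFun] at this
      simpa using this
    rw [hm']
    simp [hx]
  have hξf : ∀ f : H, inner ℝ ξ f = (∫ x, f x) - c * ∑ i, f (p i) := by
    intro f
    rw [hξ, inner_sub_left, hm', inner_smul_left, sum_inner]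
    simp [hk]
  have hcard : (Fintype.card ι : ℝ) ≠ 0 := by positivity
  have hnorm : ‖ξ‖ = √(-1 + c ^ 2 * ∑ i, ∑ j, K (p i) (p j)) := by
    rw [← Real.sqrt_sq (norm_nonneg ξ), ← real_inner_self_eq_norm_sq]
    congr 1
    rw [hξ, inner_sub_left, inner_sub_right, inner_sub_right, hmm, inner_smul_left,
      inner_smul_right, inner_smul_left, inner_smul_right, inner_sum, sum_inner]
    simp only [real_inner_comm m, hmk, sum_inner, inner_sum, hkk]
    simp only [Finset.sum_const, Finset.card_univ, nsmul_eq_mul, mul_one]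
    have : c * (Fintype.card ι : ℝ) = 1 := by rw [hcdef]; field_simp
    simp only [RCLike.conj_to_real, this]
    rw [Finset.sum_comm]
    ring
  rw [← hnorm]
  unfold worstCaseError
  simp only [← hcdef, ← hξf]
  refine le_antisymm (iSup₂_le fun f hf => ENNReal.ofReal_le_ofReal ?_) ?_
  · calc |inner ℝ ξ f| ≤ ‖ξ‖ * ‖f‖ := abs_real_inner_le_norm _ _
      _ ≤ ‖ξ‖ := mul_le_of_le_one_right (norm_nonneg _) hf
  · by_cases h0 : ξ = 0
    · simp [h0]
    · have hpos : ‖ξ‖ ≠ 0 := norm_ne_zero_iff.mpr h0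
      -- The supremum is attained at the normalized representer.
      refine le_iSup₂_of_le (‖ξ‖⁻¹ • ξ) ?_ ?_
      · rw [norm_smul, norm_inv, norm_norm, inv_mul_cancel₀ hpos]
      · rw [inner_smul_right, real_inner_self_eq_norm_sq]
        refine ENNReal.ofReal_le_ofReal (le_of_eq ?_)
        rw [sq, ← mul_assoc, inv_mul_cancel₀ hpos, one_mul, abs_of_nonneg (norm_nonneg _)]

end RKHSError

/-! ### Möbius-weighted averaging over residues -/

section MoebiusWeights

open ArithmeticFunction

/-- The number of solutions `u` of `d u = g` in `ℤ/N`. -/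
theorem card_filter_natCast_mul_eq {N : ℕ} [NeZero N] (d : ℕ) (g : ZMod N) :
    (Finset.univ.filter fun u : ZMod N => (d : ZMod N) * u = g).card
      = if Nat.gcd d N ∣ g.val then Nat.gcd d N else 0 := by
  have hN : N ≠ 0 := NeZero.ne N
  have hrange : g ∈ Set.range (nsmulAddMonoidHom d : ZMod N →+ ZMod N) ↔ Nat.gcd d N ∣ g.val := by
    have h1 := Int.gcd_dvd_iff (a := d) (b := N) (n := g.val)
    rw [Int.gcd_natCast_natCast] at h1
    rw [h1]
    constructor
    · rintro ⟨u, hu⟩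
      have h2 : ((g.val : ℤ) : ZMod N) = ((d * u.val : ℤ) : ZMod N) := by
        push_cast
        rw [ZMod.natCast_zmod_val, ZMod.natCast_zmod_val, ← hu]
        simp
      rw [ZMod.intCast_eq_intCast_iff_dvd_sub] at h2
      obtain ⟨k, hk⟩ := h2
      exact ⟨u.val, -k, by linarith⟩
    · rintro ⟨x, y, h⟩
      refine ⟨(x : ZMod N), ?_⟩
      have h2 : ((g.val : ℤ) : ZMod N) = ((d * x + N * y : ℤ) : ZMod N) := by rw [h]
      push_cast at h2
      rw [ZMod.natCast_zmod_val, ZMod.natCast_self, zero_mul, add_zero] at h2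
      simp [h2]
  have hfilter : (Finset.univ.filter fun u : ZMod N => (d : ZMod N) * u = g)
      = Finset.univ.filter fun u : ZMod N => (nsmulAddMonoidHom d : ZMod N →+ ZMod N) u = g := by
    ext u
    simp
  rw [hfilter]
  split_ifs with h
  · rw [AddMonoidHom.card_fiber_eq_of_mem_range (nsmulAddMonoidHom d : ZMod N →+ ZMod N)
      (hrange.2 h) (y := 0) ⟨0, map_zero _⟩]
    have h3 := IsAddCyclic.card_nsmulAddMonoidHom_ker (G := ZMod N) d
    rw [Nat.card_zmod, Nat.gcd_comm] at h3
    rw [← h3, Nat.card_eq_fintype_card]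
    refine (Fintype.card_of_subtype _ fun u => ?_).symm
    simp
  · rw [Finset.card_eq_zero, Finset.filter_eq_empty_iff]
    exact fun u _ hu => h (hrange.1 ⟨u, hu⟩)

/-- The Möbius weight of `g ∈ ℤ/N`. Up to a constant factor these weights are the law of a random
`g` for which `h g` is uniformly distributed on `ℤ/N` when `h` has law proportional to `h^{-t}`. -/
def moebiusWeight (N : ℕ) [NeZero N] (t : ℝ) (g : ZMod N) : ℝ :=
  ∑' d : ℕ, (moebius d : ℝ) * (d : ℝ) ^ (-t) *
    (Finset.univ.filter fun u : ZMod N => (d : ZMod N) * u = g).card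

theorem summable_natCast_rpow_neg {t : ℝ} (ht : 1 < t) : Summable fun d : ℕ => (d : ℝ) ^ (-t) :=
  Real.summable_nat_rpow.2 (by linarith)

theorem summable_pnat_rpow_neg {t : ℝ} (ht : 1 < t) : Summable fun d : ℕ+ => (d : ℝ) ^ (-t) :=
  (summable_natCast_rpow_neg ht).comp_injective PNat.coe_injective

theorem abs_moebius_real_le_one (d : ℕ) : |(moebius d : ℝ)| ≤ 1 := by
  exact_mod_cast abs_moebius_le_one (n := d)

theorem summable_norm_moebiusWeight {N : ℕ} [NeZero N] {t : ℝ} (ht : 1 < t) (g : ZMod N) :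
    Summable fun d : ℕ => ‖(moebius d : ℝ) * (d : ℝ) ^ (-t) *
      (Finset.univ.filter fun u : ZMod N => (d : ZMod N) * u = g).card‖ := by
  refine Summable.of_nonneg_of_le (fun _ => norm_nonneg _) (fun d => ?_)
    ((summable_natCast_rpow_neg ht).mul_right (N : ℝ))
  have h1 : ((Finset.univ.filter fun u : ZMod N => (d : ZMod N) * u = g).card : ℝ) ≤ N := by
    have := Finset.card_filter_le Finset.univ fun u : ZMod N => (d : ZMod N) * u = g
    rw [Finset.card_univ, ZMod.card] at this
    exact_mod_cast this
  have h2 : (0 : ℝ) ≤ (d : ℝ) ^ (-t) := by positivity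
  rw [norm_mul, norm_mul, Real.norm_of_nonneg h2, Real.norm_natCast, Real.norm_eq_abs]
  have h3 := abs_moebius_real_le_one d
  calc _ ≤ 1 * (d : ℝ) ^ (-t) * (N : ℝ) := by gcongr
    _ = _ := by ring

/-- The solution count is multiplicative in `d`, so the series has an Euler product. Its factor at
`p` is `1 - p^(-t) #{u : p u = g}`, which is nonnegative because the count is at most `p` and `t >
1`. -/
theorem moebiusWeight_nonneg {N : ℕ} [NeZero N] {t : ℝ} (ht : 1 < t) (g : ZMod N) :
    0 ≤ moebiusWeight N t g := by
  set f : ℕ → ℝ := fun d => (moebius d : ℝ) * (d : ℝ) ^ (-t) *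
    (Finset.univ.filter fun u : ZMod N => (d : ZMod N) * u = g).card with hf
  have hf1 : f 1 = 1 := by simp [hf, Finset.filter_eq']
  have hf0 : f 0 = 0 := by simp [hf]
  have hmul : ∀ {m n : ℕ}, m.Coprime n → f (m * n) = f m * f n := by
    intro m n hmn
    have hc : ((if Nat.gcd (m * n) N ∣ g.val then Nat.gcd (m * n) N else 0 : ℕ) : ℝ)
        = (if Nat.gcd m N ∣ g.val then Nat.gcd m N else 0 : ℕ) *
          (if Nat.gcd n N ∣ g.val then Nat.gcd n N else 0 : ℕ) := by
      have hg : Nat.gcd (m * n) N = Nat.gcd m N * Nat.gcd n N := by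
        rw [Nat.gcd_comm, Nat.Coprime.gcd_mul _ hmn, Nat.gcd_comm, Nat.gcd_comm N n]
      have hcop : (Nat.gcd m N).Coprime (Nat.gcd n N) :=
        Nat.Coprime.of_dvd (Nat.gcd_dvd_left _ _) (Nat.gcd_dvd_left _ _) hmn
      have hdvd : Nat.gcd (m * n) N ∣ g.val ↔ Nat.gcd m N ∣ g.val ∧ Nat.gcd n N ∣ g.val := by
        rw [hg]
        exact ⟨fun h => ⟨(dvd_mul_right _ _).trans h, (dvd_mul_left _ _).trans h⟩,
          fun h => hcop.mul_dvd_of_dvd_of_dvd h.1 h.2⟩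
      rw [← Nat.cast_mul]
      rw [hg] at hdvd ⊢
      congr 1
      by_cases h1 : Nat.gcd m N ∣ g.val <;> by_cases h2 : Nat.gcd n N ∣ g.val <;>
        simp [hdvd, h1, h2]
    simp only [hf, card_filter_natCast_mul_eq]
    rw [hc, isMultiplicative_moebius.map_mul_of_coprime hmn]
    push_cast
    rw [Real.mul_rpow (by positivity) (by positivity)]
    ring
  have hprod := EulerProduct.eulerProduct_hasProd hf1 hmul (summable_norm_moebiusWeight ht g) hf0
  refine ge_of_tendsto' hprod fun s => Finset.prod_nonneg fun p _ => ?_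
  have hp := p.2
  -- `μ(p^e) = 0` for `e ≥ 2`, so only the first two terms survive.
  have hsum : ∑' e, f (p ^ e) = 1 + f p := by
    rw [tsum_eq_sum (s := Finset.range 2)]
    · simp [Finset.sum_range_succ, hf1]
    · intro e he
      have he2 : 1 < e := by simpa using he
      have : moebius ((p : ℕ) ^ e) = 0 := by
        rw [moebius_apply_prime_pow hp (by omega), if_neg (by omega)]
      simp [hf, this]
  rw [hsum]
  have hcard : ((Finset.univ.filter fun u : ZMod N => ((p : ℕ) : ZMod N) * u = g).card : ℝ)
      ≤ (p : ℕ) := by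
    rw [card_filter_natCast_mul_eq]
    split_ifs
    · exact_mod_cast Nat.gcd_le_left _ hp.pos
    · simp
  have hpow : ((p : ℕ) : ℝ) ^ (-t) * ((p : ℕ) : ℝ) ≤ 1 := by
    have hp0 : (0 : ℝ) < (p : ℕ) := by exact_mod_cast hp.pos
    have hp1 : (1 : ℝ) ≤ (p : ℕ) := by exact_mod_cast hp.one_le
    nth_rw 2 [← Real.rpow_one ((p : ℕ) : ℝ)]
    rw [← Real.rpow_add hp0]
    exact Real.rpow_le_one_of_one_le_of_nonpos hp1 (by linarith)
  have h2 : (0 : ℝ) ≤ ((p : ℕ) : ℝ) ^ (-t) := by positivity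
  have : f p = -(((p : ℕ) : ℝ) ^ (-t) *
      (Finset.univ.filter fun u : ZMod N => ((p : ℕ) : ZMod N) * u = g).card) := by
    simp only [hf, moebius_apply_prime hp]
    push_cast
    ring
  rw [this]
  nlinarith [mul_le_mul_of_nonneg_left hcard h2]

theorem moebiusWeight_eq_tsum_pnat (N : ℕ) [NeZero N] (t : ℝ) (g : ZMod N) :
    moebiusWeight N t g = ∑' d : ℕ+, (moebius d : ℝ) * (d : ℝ) ^ (-t) *
      (Finset.univ.filter fun u : ZMod N => ((d : ℕ) : ZMod N) * u = g).card := by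
  refine (PNat.coe_injective.tsum_eq (f := fun d : ℕ => (moebius d : ℝ) * (d : ℝ) ^ (-t) *
    ((Finset.univ.filter fun u : ZMod N => (d : ZMod N) * u = g).card : ℝ)) ?_).symm
  intro d hd
  have : d ≠ 0 := by
    rintro rfl
    simp at hd
  exact ⟨⟨d, Nat.pos_of_ne_zero this⟩, rfl⟩

theorem summable_moebius_mul_dilation {t : ℝ} (ht : 1 < t) {F : ℕ → ℝ} {C : ℝ}
    (hF : ∀ n, |F n| ≤ C * (n : ℝ) ^ (-t)) :
    Summable fun p : ℕ+ × ℕ+ => (moebius p.1 : ℝ) * F (p.1 * p.2) := by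
  have hs := ((summable_pnat_rpow_neg ht).mul_of_nonneg (summable_pnat_rpow_neg ht)
    (fun _ => by positivity) (fun _ => by positivity)).mul_left C
  refine Summable.of_norm_bounded hs fun p => ?_
  rw [norm_mul]
  have h1 := abs_moebius_real_le_one p.1
  have h2 := hF (p.1 * p.2)
  push_cast at h2
  rw [Real.mul_rpow (by positivity) (by positivity)] at h2
  simpa using mul_le_mul h1 h2 (abs_nonneg _) zero_le_one

/-- Möbius inversion for absolutely convergent sums over dilations. -/
theorem tsum_moebius_mul_dilation {t : ℝ} (ht : 1 < t) {F : ℕ → ℝ} {C : ℝ}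
    (hF : ∀ n, |F n| ≤ C * (n : ℝ) ^ (-t)) :
    ∑' p : ℕ+ × ℕ+, (moebius p.1 : ℝ) * F (p.1 * p.2) = F 1 := by
  have hs := summable_moebius_mul_dilation ht hF
  rw [← sigmaAntidiagonalEquivProd.tsum_eq]
  have hs' : Summable fun c : (Σ n : ℕ+, Nat.divisorsAntidiagonal n) =>
      (moebius (sigmaAntidiagonalEquivProd c).1 : ℝ) *
        F ((sigmaAntidiagonalEquivProd c).1 * (sigmaAntidiagonalEquivProd c).2) :=
    (sigmaAntidiagonalEquivProd.summable_iff).2 hs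
  rw [hs'.tsum_sigma]
  -- Grouping the pairs by their product `n` leaves `F n` times `∑_{d ∣ n} μ(d)`, which vanishes
  -- unless `n = 1`.
  have hin : ∀ n : ℕ+, ∑' c : Nat.divisorsAntidiagonal n,
      (moebius (sigmaAntidiagonalEquivProd ⟨n, c⟩).1 : ℝ) *
        F ((sigmaAntidiagonalEquivProd ⟨n, c⟩).1 * (sigmaAntidiagonalEquivProd ⟨n, c⟩).2)
      = if n = 1 then F 1 else 0 := by
    intro n
    have h1 : ∀ c : Nat.divisorsAntidiagonal n,
        (moebius (sigmaAntidiagonalEquivProd ⟨n, c⟩).1 : ℝ) *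
          F ((sigmaAntidiagonalEquivProd ⟨n, c⟩).1 * (sigmaAntidiagonalEquivProd ⟨n, c⟩).2)
        = (moebius c.1.1 : ℝ) * F n := by
      intro c
      have := (Nat.mem_divisorsAntidiagonal.1 c.2).1
      simp [sigmaAntidiagonalEquivProd, divisorsAntidiagonalFactors, this]
    simp only [h1]
    rw [tsum_fintype, ← Finset.sum_mul, Finset.univ_eq_attach,
      (n : ℕ).divisorsAntidiagonal.sum_attach fun x : ℕ × ℕ => (moebius x.1 : ℝ)]
    have h2 : ∑ x ∈ (n : ℕ).divisorsAntidiagonal, moebius x.1 = if (n : ℕ) = 1 then 1 else 0 := by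
      have h3 := congrArg (fun f => f (n : ℕ)) moebius_mul_coe_zeta
      simp only [mul_apply, one_apply] at h3
      rw [← h3]
      refine Finset.sum_congr rfl fun x hx => ?_
      have hx2 : x.2 ≠ 0 := by
        have := Nat.ne_zero_of_mem_divisorsAntidiagonal hx
        exact this.2
      simp [hx2]
    have h4 : ∑ x ∈ (n : ℕ).divisorsAntidiagonal, (moebius x.1 : ℝ)
        = if (n : ℕ) = 1 then 1 else 0 := by
      exact_mod_cast h2
    rw [h4]
    by_cases hn : n = 1
    · simp [hn]
    · have : (n : ℕ) ≠ 1 := fun h => hn (PNat.coe_eq_one_iff.1 h)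
      simp [hn, this]
  simp only [hin]
  exact tsum_ite_eq 1 _

/-- Summing over `g` first, with `g = d u`, turns the left side into `∑ μ(d) (dh)^(-t) ∑_u W(dhu)`.
This depends on the pair only through `dh` apart from `μ(d)`, so Möbius inversion keeps just `dh =
1`. No coprimality with `N` is needed. -/
theorem sum_moebiusWeight_mul_tsum {N : ℕ} [NeZero N] {t : ℝ} (ht : 1 < t) (W : ZMod N → ℝ) :
    ∑ g, moebiusWeight N t g * ∑' h : ℕ+, (h : ℝ) ^ (-t) * W ((h : ℕ) * g) = ∑ c, W c := by
  set F : ℕ → ℝ := fun n => (n : ℝ) ^ (-t) * ∑ u : ZMod N, W (n * u) with hF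
  set B := ∑ c, |W c| with hB
  have hWB : ∀ c, |W c| ≤ B := fun c =>
    Finset.single_le_sum (f := fun c => |W c|) (fun _ _ => abs_nonneg _) (Finset.mem_univ c)
  have hbound : ∀ n, |F n| ≤ (N * B) * (n : ℝ) ^ (-t) := by
    intro n
    have h0 : (0 : ℝ) ≤ (n : ℝ) ^ (-t) := by positivity
    rw [hF, abs_mul, abs_of_nonneg h0, mul_comm]
    refine mul_le_mul_of_nonneg_right ?_ h0
    refine (Finset.abs_sum_le_sum_abs _ _).trans ((Finset.sum_le_sum fun u _ => hWB _).trans ?_)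
    simp
  have hsW : ∀ g : ZMod N, Summable fun h : ℕ+ => (h : ℝ) ^ (-t) * W ((h : ℕ) * g) := by
    intro g
    refine Summable.of_norm_bounded ((summable_pnat_rpow_neg ht).mul_right B) fun h => ?_
    have h0 : (0 : ℝ) ≤ (h : ℝ) ^ (-t) := by positivity
    rw [norm_mul, Real.norm_of_nonneg h0]
    exact mul_le_mul_of_nonneg_left (hWB _) h0
  have hsQ : ∀ g : ZMod N, Summable fun d : ℕ+ => (moebius d : ℝ) * (d : ℝ) ^ (-t) *
      (Finset.univ.filter fun u : ZMod N => ((d : ℕ) : ZMod N) * u = g).card := fun g =>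
    ((summable_norm_moebiusWeight ht g).of_norm).comp_injective PNat.coe_injective
  have hsprod : ∀ g : ZMod N, Summable fun p : ℕ+ × ℕ+ => ((moebius p.1 : ℝ) * (p.1 : ℝ) ^ (-t) *
      (Finset.univ.filter fun u : ZMod N => ((p.1 : ℕ) : ZMod N) * u = g).card) *
        ((p.2 : ℝ) ^ (-t) * W ((p.2 : ℕ) * g)) := fun g =>
    summable_mul_of_summable_norm (hsQ g).norm (hsW g).norm
  rw [show ∑ c, W c = F 1 by simp [hF], ← tsum_moebius_mul_dilation ht hbound]
  simp only [moebiusWeight_eq_tsum_pnat]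
  have : ∀ g : ZMod N, (∑' d : ℕ+, (moebius d : ℝ) * (d : ℝ) ^ (-t) *
      ((Finset.univ.filter fun u : ZMod N => ((d : ℕ) : ZMod N) * u = g).card : ℝ)) *
        (∑' h : ℕ+, (h : ℝ) ^ (-t) * W ((h : ℕ) * g)) = _ := fun g =>
    (hsQ g).tsum_mul_tsum (hsW g) (hsprod g)
  simp only [this]
  rw [← Summable.tsum_finsetSum fun g _ => hsprod g]
  refine tsum_congr fun p => ?_
  have hre : ∑ u : ZMod N, W (((p.1 * p.2 : ℕ) : ZMod N) * u) = ∑ g : ZMod N,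
      ((Finset.univ.filter fun u : ZMod N => ((p.1 : ℕ) : ZMod N) * u = g).card : ℝ) *
        W ((p.2 : ℕ) * g) := by
    rw [← Finset.sum_fiberwise Finset.univ fun u : ZMod N => ((p.1 : ℕ) : ZMod N) * u]
    refine Finset.sum_congr rfl fun g _ => ?_
    rw [← nsmul_eq_mul, ← Finset.sum_const]
    refine Finset.sum_congr rfl fun u hu => ?_
    rw [← (Finset.mem_filter.1 hu).2]
    push_cast
    congr 1
    ring
  simp only [hF]
  rw [hre]
  push_cast
  rw [Real.mul_rpow (by positivity) (by positivity), Finset.mul_sum, Finset.mul_sum]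
  exact Finset.sum_congr rfl fun g _ => by ring

/-- Averaging over the nonzero residues with the Möbius weights: the bound is as for a prime
modulus. -/
theorem exists_ne_zero_tsum_le {N : ℕ} [NeZero N] (hN : 2 ≤ N) {t : ℝ} (ht : 1 < t) {W : ZMod N → ℝ}
    (hW : ∀ c, 0 ≤ W c) : ∃ z : ZMod N, z ≠ 0 ∧
      ∑' h : ℕ+, (h : ℝ) ^ (-t) * W ((h : ℕ) * z)
        ≤ (∑' h : ℕ+, (h : ℝ) ^ (-t)) * (∑ c, W c) / (N - 1) := by
  set Z := ∑' h : ℕ+, (h : ℝ) ^ (-t) with hZ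
  have hZpos : 0 < Z := (summable_pnat_rpow_neg ht).tsum_pos (fun _ => by positivity) 1 (by simp)
  have hN1 : (0 : ℝ) < N - 1 := by
    have : (2 : ℝ) ≤ N := by exact_mod_cast hN
    linarith
  set Q := moebiusWeight N t with hQ
  have hQ0 : ∀ g, 0 ≤ Q g := moebiusWeight_nonneg ht
  have hmass : (∑ g, Q g) * Z = N := by
    -- The constant `W = 1` computes the total mass; the indicator of `0` below bounds the mass at
    -- `0`, since the remaining terms are nonnegative.
    have := sum_moebiusWeight_mul_tsum (N := N) ht fun _ => 1
    simpa [← hZ, ← hQ, Finset.sum_mul] using this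
  have hzero : Q 0 * Z ≤ 1 := by
    have h1 := sum_moebiusWeight_mul_tsum (N := N) ht fun c => if c = 0 then 1 else 0
    rw [Finset.sum_ite_eq' Finset.univ (0 : ZMod N)] at h1
    simp only [Finset.mem_univ, if_true] at h1
    rw [← h1]
    have h2 := Finset.single_le_sum (f := fun g => moebiusWeight N t g *
      ∑' h : ℕ+, (h : ℝ) ^ (-t) * if ((h : ℕ) : ZMod N) * g = 0 then 1 else 0) (fun g _ =>
        mul_nonneg (hQ0 g) (tsum_nonneg fun h => mul_nonneg (by positivity) (by positivity)))
        (Finset.mem_univ (0 : ZMod N))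
    simpa [← hZ, ← hQ] using h2
  -- If every nonzero residue exceeded the bound, the weighted sum over nonzero residues, whose mass
  -- is at least `(N - 1)/Z`, would already exceed `∑ W`, contradicting the averaging identity.
  by_contra! hcon
  set θ : ZMod N → ℝ := fun z => ∑' h : ℕ+, (h : ℝ) ^ (-t) * W ((h : ℕ) * z) with hθ
  have hθ0 : ∀ z, 0 ≤ θ z := fun z => tsum_nonneg fun h => mul_nonneg (by positivity) (hW _)
  have hsplit : ∀ f : ZMod N → ℝ, ∑ g, f g = f 0 + ∑ g ∈ Finset.univ.erase 0, f g := fun f =>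
    (Finset.add_sum_erase _ _ (Finset.mem_univ 0)).symm
  have htotal : ∑ g, Q g * θ g = ∑ c, W c := sum_moebiusWeight_mul_tsum ht W
  have hrest : (N - 1 : ℝ) / Z ≤ ∑ g ∈ Finset.univ.erase (0 : ZMod N), Q g := by
    rw [div_le_iff₀ hZpos]
    have := hmass
    rw [hsplit Q, add_mul] at this
    linarith
  have hpos : 0 < ∑ g ∈ Finset.univ.erase (0 : ZMod N), Q g := lt_of_lt_of_le (by positivity) hrest
  obtain ⟨g₀, hg₀, hg₀pos⟩ : ∃ g ∈ Finset.univ.erase (0 : ZMod N), 0 < Q g := by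
    by_contra! h
    exact absurd hpos (not_lt.2 (Finset.sum_nonpos h))
  have hlt : (∑ g ∈ Finset.univ.erase (0 : ZMod N), Q g) * (Z * (∑ c, W c) / (N - 1))
      < ∑ g ∈ Finset.univ.erase (0 : ZMod N), Q g * θ g := by
    rw [Finset.sum_mul]
    refine Finset.sum_lt_sum (fun g hg => ?_) ⟨g₀, hg₀, ?_⟩
    · exact mul_le_mul_of_nonneg_left (hcon g (Finset.ne_of_mem_erase hg)).le (hQ0 g)
    · exact mul_lt_mul_of_pos_left (hcon g₀ (Finset.ne_of_mem_erase hg₀)) hg₀pos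
  have hWsum : 0 ≤ ∑ c, W c := Finset.sum_nonneg fun c _ => hW c
  have hle : ∑ c, W c ≤ (∑ g ∈ Finset.univ.erase (0 : ZMod N), Q g) *
      (Z * (∑ c, W c) / (N - 1)) := by
    calc ∑ c, W c = (N - 1 : ℝ) / Z * (Z * (∑ c, W c) / (N - 1)) := by field_simp
      _ ≤ _ := by gcongr
  have h0 : 0 ≤ Q 0 * θ 0 := mul_nonneg (hQ0 0) (hθ0 0)
  have := htotal
  rw [hsplit fun g => Q g * θ g] at this
  linarith

end MoebiusWeights

/-! ### Sums over the dual lattice and their symmetrized analogues -/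

section DualSums

variable {N : ℕ} [NeZero N]

/-- `cos (2π v / N)` for a residue `v` modulo `N`. -/
def residueCos (v : ZMod N) : ℝ := (ZMod.stdAddChar v).re

theorem residueCos_intCast (h : ℤ) :
    residueCos (h : ZMod N) = Real.cos (2 * Real.pi * h / N) := by
  have e : 2 * (Real.pi : ℂ) * Complex.I * h / N
      = ((2 * Real.pi * h / N : ℝ) : ℂ) * Complex.I := by
    push_cast
    ring
  rw [residueCos, ZMod.stdAddChar_coe, e, Complex.exp_ofReal_mul_I_re]

theorem abs_residueCos_le_one (v : ZMod N) : |residueCos v| ≤ 1 := by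
  obtain ⟨h, rfl⟩ := ZMod.intCast_surjective v
  rw [residueCos_intCast]
  exact Real.abs_cos_le_one _

theorem residueCos_zero : residueCos (0 : ZMod N) = 1 := by simp [residueCos]

theorem residueCos_mul (v w : ZMod N) :
    residueCos v * residueCos w = (residueCos (v + w) + residueCos (v - w)) / 2 := by
  obtain ⟨h, rfl⟩ := ZMod.intCast_surjective v
  obtain ⟨k, rfl⟩ := ZMod.intCast_surjective w
  rw [← Int.cast_add, ← Int.cast_sub]
  simp only [residueCos_intCast]
  have h1 : 2 * Real.pi * ((h + k : ℤ) : ℝ) / N = 2 * Real.pi * h / N + 2 * Real.pi * k / N := by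
    push_cast
    ring
  have h2 : 2 * Real.pi * ((h - k : ℤ) : ℝ) / N = 2 * Real.pi * h / N - 2 * Real.pi * k / N := by
    push_cast
    ring
  rw [h1, h2, Real.cos_add, Real.cos_sub]
  ring

theorem sum_stdAddChar_mul (w : ZMod N) :
    ∑ n : ZMod N, ZMod.stdAddChar (n * w) = if w = 0 then (N : ℂ) else 0 := by
  rw [AddChar.sum_mulShift w (ZMod.isPrimitive_stdAddChar N), ZMod.card]
  split_ifs <;> simp

theorem sum_residueCos_mul (w : ZMod N) :
    ∑ n : ZMod N, residueCos (n * w) = if w = 0 then (N : ℝ) else 0 := by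
  have := congrArg Complex.re (sum_stdAddChar_mul w)
  rw [Complex.re_sum] at this
  simp only [residueCos, this]
  split_ifs <;> simp

/-- Each product-to-sum step absorbs a factor into the frequency `w` and halves a sum of two shorter
instances. The free `w` is what lets the induction run; at the end the sum is `N` or `0`. -/
theorem sum_residueCos_mul_prod_nonneg {d : ℕ} (w : ZMod N) (k : Fin d → ZMod N) :
    0 ≤ ∑ n : ZMod N, residueCos (n * w) * ∏ j, residueCos (n * k j) := by
  induction d generalizing w with
  | zero =>
    simp only [Finset.univ_eq_empty, Finset.prod_empty, mul_one, sum_residueCos_mul]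
    split_ifs <;> simp
  | succ d ih =>
    have h : ∑ n : ZMod N, residueCos (n * w) * ∏ j, residueCos (n * k j)
        = (∑ n : ZMod N, residueCos (n * (w + k 0)) * ∏ j : Fin d, residueCos (n * k j.succ)
          + ∑ n : ZMod N, residueCos (n * (w - k 0)) * ∏ j : Fin d, residueCos (n * k j.succ))
            / 2 := by
      rw [← Finset.sum_add_distrib, Finset.sum_div]
      refine Finset.sum_congr rfl fun n _ => ?_
      rw [Fin.prod_univ_succ, ← mul_assoc, residueCos_mul, mul_add, mul_sub]
      ring
    rw [h]
    have h1 := ih (w + k 0) fun j => k j.succ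
    have h2 := ih (w - k 0) fun j => k j.succ
    positivity

/-- The mean of `n ↦ ∏ cos (2π h_j g_j n / N)` over the residues `n`. -/
def cosMean {d : ℕ} (g h : Fin d → ZMod N) : ℝ :=
  (1 / (N : ℝ)) * ∑ n : ZMod N, ∏ j, residueCos (n * (h j * g j))

theorem cosMean_nonneg {d : ℕ} (g h : Fin d → ZMod N) : 0 ≤ cosMean g h := by
  have := sum_residueCos_mul_prod_nonneg 0 fun j => h j * g j
  simp only [mul_zero, residueCos_zero, one_mul] at this
  exact mul_nonneg (by positivity) this

theorem cosMean_le_one {d : ℕ} (g h : Fin d → ZMod N) : cosMean g h ≤ 1 := by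
  have hN : (N : ℝ) ≠ 0 := Nat.cast_ne_zero.2 (NeZero.ne N)
  have h1 : ∑ n : ZMod N, ∏ j, residueCos (n * (h j * g j)) ≤ ∑ _n : ZMod N, (1 : ℝ) := by
    refine Finset.sum_le_sum fun n _ => (le_abs_self _).trans ?_
    rw [Finset.abs_prod]
    exact Finset.prod_le_one (fun _ _ => abs_nonneg _) fun _ _ => abs_residueCos_le_one _
  calc cosMean g h ≤ (1 / (N : ℝ)) * ∑ _n : ZMod N, (1 : ℝ) :=
        mul_le_mul_of_nonneg_left h1 (by positivity)
    _ = 1 := by simp [ZMod.card, hN]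

/-- The sum of the product weight `∏ R_j(h_j)` over the dual lattice `∑ h_j g_j = 0`. -/
def dualSum {d : ℕ} (R : Fin d → ZMod N → ℝ) (g : Fin d → ZMod N) : ℝ :=
  ∑ h : Fin d → ZMod N, (∏ j, R j (h j)) * if ∑ j, h j * g j = 0 then 1 else 0

/-- The symmetrized analogue of `dualSum`. -/
def symDualSum {d : ℕ} (R : Fin d → ZMod N → ℝ) (g : Fin d → ZMod N) : ℝ :=
  ∑ h : Fin d → ZMod N, (∏ j, R j (h j)) * cosMean g h ^ 2

/-- Substituting `-v` replaces the character by its conjugate, so an even weight sees only the real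
part. -/
theorem sum_even_mul_stdAddChar {R : ZMod N → ℝ} (hR : ∀ v, R (-v) = R v) (w : ZMod N) :
    ∑ v, (R v : ℂ) * ZMod.stdAddChar (v * w) = ((∑ v, R v * residueCos (v * w) : ℝ) : ℂ) := by
  have h1 : ∑ v, (R v : ℂ) * ZMod.stdAddChar (v * w)
      = ∑ v, (R v : ℂ) * (starRingEnd ℂ) (ZMod.stdAddChar (v * w)) := by
    rw [← Equiv.sum_comp (Equiv.neg (ZMod N))]
    refine Finset.sum_congr rfl fun v _ => ?_
    rw [Equiv.neg_apply, hR, neg_mul, AddChar.map_neg_eq_conj]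
  have h2 : (2 : ℂ) * ∑ v, (R v : ℂ) * ZMod.stdAddChar (v * w)
      = 2 * ((∑ v, R v * residueCos (v * w) : ℝ) : ℂ) := by
    rw [two_mul]
    nth_rw 2 [h1]
    rw [← Finset.sum_add_distrib, Complex.ofReal_sum, Finset.mul_sum]
    refine Finset.sum_congr rfl fun v _ => ?_
    rw [← mul_add, Complex.add_conj, residueCos]
    push_cast
    ring
  exact mul_left_cancel₀ two_ne_zero h2

theorem stdAddChar_sum {ι : Type*} (s : Finset ι) (f : ι → ZMod N) :
    ZMod.stdAddChar (∑ i ∈ s, f i) = ∏ i ∈ s, ZMod.stdAddChar (f i) := by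
  classical
  induction s using Finset.induction_on with
  | empty => simp
  | insert i s hi ih => rw [Finset.sum_insert hi, Finset.prod_insert hi, AddChar.map_add_eq_mul, ih]

theorem sum_prod_sum_residueCos {d : ℕ} {R : Fin d → ZMod N → ℝ} (hR : ∀ j v, R j (-v) = R j v)
    (g : Fin d → ZMod N) :
    ∑ n : ZMod N, ∏ j, ∑ v, R j v * residueCos (n * (v * g j)) = N * dualSum R g := by
  have h1 : ∀ (n : ZMod N) (j : Fin d), ((∑ v, R j v * residueCos (n * (v * g j)) : ℝ) : ℂ)
      = ∑ v, (R j v : ℂ) * ZMod.stdAddChar (n * (v * g j)) := by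
    intro n j
    have := sum_even_mul_stdAddChar (hR j) (n * g j)
    have e : ∀ v, v * (n * g j) = n * (v * g j) := fun v => by ring
    simp only [e] at this
    exact this.symm
  have h2 : ∀ n : ZMod N, ∏ j, ∑ v, (R j v : ℂ) * ZMod.stdAddChar (n * (v * g j))
      = ∑ h : Fin d → ZMod N, (∏ j, (R j (h j) : ℂ)) *
        ZMod.stdAddChar (n * ∑ j, h j * g j) := by
    intro n
    rw [Finset.prod_univ_sum, Fintype.piFinset_univ]
    refine Finset.sum_congr rfl fun h _ => ?_
    rw [Finset.prod_mul_distrib, Finset.mul_sum, stdAddChar_sum]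
  have key : ((∑ n : ZMod N, ∏ j, ∑ v, R j v * residueCos (n * (v * g j)) : ℝ) : ℂ)
      = ((N * dualSum R g : ℝ) : ℂ) := by
    rw [Complex.ofReal_sum]
    simp only [Complex.ofReal_prod, h1, h2]
    rw [Finset.sum_comm, dualSum]
    simp only [← Finset.mul_sum, sum_stdAddChar_mul]
    push_cast
    rw [Finset.mul_sum]
    refine Finset.sum_congr rfl fun h _ => ?_
    split_ifs <;> push_cast <;> ring
  exact_mod_cast key

/-- The summand depends on `n - m` only, so one of the two sums contributes just a factor `N`. -/
theorem sum_sum_prod_sum_residueCos_sub {d : ℕ} {R : Fin d → ZMod N → ℝ}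
    (hR : ∀ j v, R j (-v) = R j v) (g : Fin d → ZMod N) :
    ∑ n : ZMod N, ∑ m : ZMod N, ∏ j, ∑ v, R j v * residueCos ((n - m) * (v * g j))
      = N ^ 2 * dualSum R g := by
  have h : ∀ m : ZMod N, ∑ n : ZMod N, ∏ j, ∑ v, R j v * residueCos ((n - m) * (v * g j))
      = N * dualSum R g := by
    intro m
    rw [← sum_prod_sum_residueCos hR g]
    exact Equiv.sum_comp (Equiv.subRight m)
      fun n => ∏ j, ∑ v, R j v * residueCos (n * (v * g j))
  rw [Finset.sum_comm]
  simp only [h]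
  simp [ZMod.card]
  ring

theorem sum_mul_cosMean {d : ℕ} {R : Fin d → ZMod N → ℝ} (hR : ∀ j v, R j (-v) = R j v)
    (g : Fin d → ZMod N) :
    ∑ h : Fin d → ZMod N, (∏ j, R j (h j)) * cosMean g h = dualSum R g := by
  have hN : (N : ℝ) ≠ 0 := Nat.cast_ne_zero.2 (NeZero.ne N)
  have h1 := sum_prod_sum_residueCos hR g
  simp only [Finset.prod_univ_sum, Fintype.piFinset_univ, Finset.prod_mul_distrib] at h1
  rw [Finset.sum_comm] at h1
  simp only [← Finset.mul_sum] at h1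
  refine mul_left_cancel₀ hN ?_
  rw [← h1, Finset.mul_sum]
  refine Finset.sum_congr rfl fun h _ => ?_
  rw [cosMean]
  field_simp

/-- By evenness `dualSum` equals the sum weighted by `cosMean` instead of the indicator, and
`cosMean ^ 2 ≤ cosMean` because `cosMean` lies in `[0,1]`. -/
theorem symDualSum_le_dualSum {d : ℕ} {R : Fin d → ZMod N → ℝ} (hR : ∀ j v, R j (-v) = R j v)
    (hR0 : ∀ j v, 0 ≤ R j v) (g : Fin d → ZMod N) : symDualSum R g ≤ dualSum R g := by
  rw [← sum_mul_cosMean hR, symDualSum]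
  refine Finset.sum_le_sum fun h _ => mul_le_mul_of_nonneg_left ?_
    (Finset.prod_nonneg fun j _ => hR0 j _)
  have h0 := cosMean_nonneg g h
  have h1 := cosMean_le_one g h
  nlinarith

theorem sum_sum_prod_sum_residueCos_mul {d : ℕ} (R : Fin d → ZMod N → ℝ) (g : Fin d → ZMod N) :
    ∑ n : ZMod N, ∑ m : ZMod N,
      ∏ j, ∑ v, R j v * (residueCos (n * (v * g j)) * residueCos (m * (v * g j)))
      = N ^ 2 * symDualSum R g := by
  have hN : (N : ℝ) ≠ 0 := Nat.cast_ne_zero.2 (NeZero.ne N)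
  simp only [Finset.prod_univ_sum, Fintype.piFinset_univ, Finset.prod_mul_distrib]
  rw [symDualSum, Finset.mul_sum]
  have h1 : ∀ h : Fin d → ZMod N, (N : ℝ) ^ 2 * ((∏ j, R j (h j)) * cosMean g h ^ 2)
      = ∑ n : ZMod N, ∑ m : ZMod N, (∏ j, R j (h j)) *
        ((∏ j, residueCos (n * (h j * g j))) * ∏ j, residueCos (m * (h j * g j))) := by
    intro h
    simp only [← Finset.mul_sum, ← Finset.sum_mul, cosMean]
    field_simp
  simp only [h1]
  conv_rhs => rw [Finset.sum_comm]
  refine Finset.sum_congr rfl fun n _ => ?_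
  rw [Finset.sum_comm]

theorem dualSum_mono {d : ℕ} {R S : Fin d → ZMod N → ℝ} (hR0 : ∀ j v, 0 ≤ R j v)
    (h : ∀ j v, R j v ≤ S j v) (g : Fin d → ZMod N) : dualSum R g ≤ dualSum S g :=
  Finset.sum_le_sum fun _ _ => mul_le_mul_of_nonneg_right
    (Finset.prod_le_prod (fun j _ => hR0 j _) fun j _ => h j _) (by positivity)

theorem dualSum_nonneg {d : ℕ} {R : Fin d → ZMod N → ℝ} (hR0 : ∀ j v, 0 ≤ R j v)
    (g : Fin d → ZMod N) : 0 ≤ dualSum R g :=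
  Finset.sum_nonneg fun _ _ => mul_nonneg (Finset.prod_nonneg fun j _ => hR0 j _) (by positivity)

theorem symDualSum_nonneg {d : ℕ} {R : Fin d → ZMod N → ℝ} (hR0 : ∀ j v, 0 ≤ R j v)
    (g : Fin d → ZMod N) : 0 ≤ symDualSum R g :=
  Finset.sum_nonneg fun _ _ => mul_nonneg (Finset.prod_nonneg fun j _ => hR0 j _) (by positivity)

theorem rpow_sum_le_sum_rpow {ι : Type*} (s : Finset ι) {f : ι → ℝ} (hf : ∀ i, 0 ≤ f i) {p : ℝ}
    (hp : 0 < p) (hp1 : p ≤ 1) : (∑ i ∈ s, f i) ^ p ≤ ∑ i ∈ s, f i ^ p := by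
  classical
  induction s using Finset.induction_on with
  | empty => simp [Real.zero_rpow hp.ne']
  | insert i s hi ih =>
    rw [Finset.sum_insert hi, Finset.sum_insert hi]
    exact (Real.rpow_add_le_add_rpow (hf i) (Finset.sum_nonneg fun j _ => hf j) hp.le hp1).trans
      (by gcongr)

/-- Powers with exponent in `(0,1]` are subadditive, and the indicator of the dual lattice, being
`0` or `1`, is unchanged by them. -/
theorem rpow_dualSum_le {d : ℕ} {R : Fin d → ZMod N → ℝ} (hR0 : ∀ j v, 0 ≤ R j v) {p : ℝ}
    (hp : 0 < p) (hp1 : p ≤ 1) (g : Fin d → ZMod N) :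
    dualSum R g ^ p ≤ dualSum (fun j v => R j v ^ p) g := by
  refine (rpow_sum_le_sum_rpow _ (fun h => mul_nonneg (Finset.prod_nonneg fun j _ => hR0 j _)
    (by positivity)) hp hp1).trans (Finset.sum_le_sum fun h _ => ?_)
  rw [Real.mul_rpow (Finset.prod_nonneg fun j _ => hR0 j _) (by positivity),
    Real.finsetProd_rpow _ _ fun j _ => hR0 j _]
  split_ifs <;> simp [Real.zero_rpow hp.ne']

theorem sum_fin_succ_arrow {d : ℕ} (F : (Fin (d + 1) → ZMod N) → ℝ) :
    ∑ h, F h = ∑ v : ZMod N, ∑ h : Fin d → ZMod N, F (Fin.snoc (α := fun _ => ZMod N) h v) := by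
  rw [← (Fin.snocEquiv fun _ : Fin (d + 1) => ZMod N).sum_comp, Fintype.sum_prod_type]
  rfl

/-- The total weight of the `h` with `∑ h_j g_j = c`. -/
def dualCosetSum {d : ℕ} (R : Fin d → ZMod N → ℝ) (g : Fin d → ZMod N) (c : ZMod N) : ℝ :=
  ∑ h : Fin d → ZMod N, (∏ j, R j (h j)) * if ∑ j, h j * g j = c then 1 else 0

theorem dualCosetSum_nonneg {d : ℕ} {R : Fin d → ZMod N → ℝ} (hR0 : ∀ j v, 0 ≤ R j v)
    (g : Fin d → ZMod N) (c : ZMod N) : 0 ≤ dualCosetSum R g c :=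
  Finset.sum_nonneg fun _ _ => mul_nonneg (Finset.prod_nonneg fun j _ => hR0 j _) (by positivity)

theorem sum_dualCosetSum {d : ℕ} (R : Fin d → ZMod N → ℝ) (g : Fin d → ZMod N) :
    ∑ c, dualCosetSum R g c = ∏ j, ∑ v, R j v := by
  simp only [dualCosetSum]
  rw [Finset.sum_comm, Finset.prod_univ_sum, Fintype.piFinset_univ]
  simp

theorem dualSum_snoc {d : ℕ} (R : Fin d → ZMod N → ℝ) (ρ : ZMod N → ℝ) (g : Fin d → ZMod N)
    (z : ZMod N) :
    dualSum (Fin.snoc (α := fun _ => ZMod N → ℝ) R ρ) (Fin.snoc (α := fun _ => ZMod N) g z)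
      = ∑ v, ρ v * dualCosetSum R g (-(v * z)) := by
  rw [dualSum, sum_fin_succ_arrow]
  refine Finset.sum_congr rfl fun v _ => ?_
  rw [dualCosetSum, Finset.mul_sum]
  refine Finset.sum_congr rfl fun h _ => ?_
  rw [Fin.prod_univ_castSucc, Fin.sum_univ_castSucc]
  simp only [Fin.snoc_castSucc, Fin.snoc_last, eq_neg_iff_add_eq_zero]
  ring

theorem symDualSum_snoc {d : ℕ} (R : Fin d → ZMod N → ℝ) (ρ : ZMod N → ℝ) (g : Fin d → ZMod N)
    (z : ZMod N) :
    symDualSum (Fin.snoc (α := fun _ => ZMod N → ℝ) R ρ) (Fin.snoc (α := fun _ => ZMod N) g z)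
      = ∑ v, ρ v * ∑ h : Fin d → ZMod N, (∏ j, R j (h j)) *
        cosMean (Fin.snoc (α := fun _ => ZMod N) g z) (Fin.snoc (α := fun _ => ZMod N) h v) ^ 2 := by
  rw [symDualSum, sum_fin_succ_arrow]
  refine Finset.sum_congr rfl fun v _ => ?_
  rw [Finset.mul_sum]
  refine Finset.sum_congr rfl fun h _ => ?_
  rw [Fin.prod_univ_castSucc]
  simp only [Fin.snoc_castSucc, Fin.snoc_last]
  ring

theorem cosMean_snoc_zero {d : ℕ} (g h : Fin d → ZMod N) (z : ZMod N) :
    cosMean (Fin.snoc (α := fun _ => ZMod N) g z) (Fin.snoc (α := fun _ => ZMod N) h 0)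
      = cosMean g h := by
  simp [cosMean, Fin.prod_univ_castSucc, residueCos_zero]

/-- A zero frequency in the last coordinate makes the new generator irrelevant, so the unit mass at
`0` reproduces the sum of the previous dimension. All dependence on `z` sits in the second summand.
-/
theorem dualSum_snoc_add_ite {d : ℕ} (R : Fin d → ZMod N → ℝ) (ρ : ZMod N → ℝ)
    (g : Fin d → ZMod N) (z : ZMod N) :
    dualSum (Fin.snoc (α := fun _ => ZMod N → ℝ) R fun v => (if v = 0 then 1 else 0) + ρ v)
        (Fin.snoc (α := fun _ => ZMod N) g z)
      = dualSum R g + dualSum (Fin.snoc (α := fun _ => ZMod N → ℝ) R ρ)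
        (Fin.snoc (α := fun _ => ZMod N) g z) := by
  simp only [dualSum_snoc, add_mul, Finset.sum_add_distrib]
  simp [dualCosetSum, dualSum]

theorem symDualSum_snoc_add_ite {d : ℕ} (R : Fin d → ZMod N → ℝ) (ρ : ZMod N → ℝ)
    (g : Fin d → ZMod N) (z : ZMod N) :
    symDualSum (Fin.snoc (α := fun _ => ZMod N → ℝ) R fun v => (if v = 0 then 1 else 0) + ρ v)
        (Fin.snoc (α := fun _ => ZMod N) g z)
      = symDualSum R g + symDualSum (Fin.snoc (α := fun _ => ZMod N → ℝ) R ρ)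
        (Fin.snoc (α := fun _ => ZMod N) g z) := by
  simp only [symDualSum_snoc, add_mul, Finset.sum_add_distrib]
  simp [cosMean_snoc_zero, symDualSum]

end DualSums

/-! ### Folding decay weights onto residue classes -/

section ResidueMass

/-- The part of `decay α γ` away from zero. -/
def decayTail (α γ : ℝ) (h : ℤ) : ℝ :=
  if h = 0 then 0 else γ * |(h : ℝ)| ^ (-2 * α)

theorem decay_eq_ite_add (α γ : ℝ) (h : ℤ) :
    decay α γ h = (if h = 0 then 1 else 0) + decayTail α γ h := by
  unfold decay decayTail
  split_ifs <;> simp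

theorem decayTail_nonneg (α : ℝ) {γ : ℝ} (hγ : 0 < γ) (h : ℤ) : 0 ≤ decayTail α γ h := by
  unfold decayTail
  split_ifs <;> positivity

theorem decayTail_neg (α γ : ℝ) (h : ℤ) : decayTail α γ (-h) = decayTail α γ h := by
  simp [decayTail]

theorem decay_neg (α γ : ℝ) (h : ℤ) : decay α γ (-h) = decay α γ h := by
  simp [decay]

theorem summable_decayTail {α : ℝ} (hα : 1 / 2 < α) (γ : ℝ) : Summable (decayTail α γ) := by
  refine (summable_congr_cofinite ?_).mp (summable_decay hα γ)
  filter_upwards [(Set.finite_singleton (0 : ℤ)).compl_mem_cofinite] with n hn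
  simp [decay, decayTail, show n ≠ 0 from hn]

theorem decayTail_rpow {γ : ℝ} (hγ : 0 < γ) (α : ℝ) {τ : ℝ} (hτ : 0 < τ) (h : ℤ) :
    decayTail α γ h ^ (1 / τ) = decayTail (α / τ) (γ ^ (1 / τ)) h := by
  unfold decayTail
  split_ifs
  · rw [Real.zero_rpow (by positivity)]
  · rw [Real.mul_rpow hγ.le (by positivity), ← Real.rpow_mul (abs_nonneg _)]
    congr 2
    ring

theorem decay_rpow {γ : ℝ} (hγ : 0 < γ) (α : ℝ) {τ : ℝ} (hτ : 0 < τ) (h : ℤ) :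
    decay α γ h ^ (1 / τ) = decay (α / τ) (γ ^ (1 / τ)) h := by
  have := decayTail_rpow hγ α hτ h
  unfold decay
  unfold decayTail at this
  split_ifs with h0
  · simp
  · simpa [h0] using this

theorem rpow_tsum_le_tsum_rpow {ι : Type*} {f : ι → ℝ} (hf : ∀ i, 0 ≤ f i) {p : ℝ}
    (hp : 0 < p) (hp1 : p ≤ 1) (hs : Summable f) (hs' : Summable fun i => f i ^ p) :
    (∑' i, f i) ^ p ≤ ∑' i, f i ^ p := by
  have ht : Filter.Tendsto (fun s : Finset ι => (∑ i ∈ s, f i) ^ p) Filter.atTop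
      (nhds ((∑' i, f i) ^ p)) :=
    Filter.Tendsto.rpow_const hs.hasSum (Or.inr hp.le)
  refine le_of_tendsto' ht fun s => (rpow_sum_le_sum_rpow s hf hp hp1).trans ?_
  exact hs'.sum_le_tsum s fun i _ => Real.rpow_nonneg (hf i) p

variable (N : ℕ)

/-- The total mass of `a : ℤ → ℝ` on the residue class `v` modulo `N`. -/
def residueMass (a : ℤ → ℝ) (v : ZMod N) : ℝ :=
  ∑' h : ℤ, if (h : ZMod N) = v then a h else 0

variable {N}

theorem summable_ite_residue {a : ℤ → ℝ} (ha : Summable a) (v : ZMod N) :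
    Summable fun h : ℤ => if (h : ZMod N) = v then a h else 0 := by
  refine Summable.of_norm_bounded ha.norm fun h => ?_
  split_ifs <;> simp

theorem sum_residueMass_mul [NeZero N] {a : ℤ → ℝ} (ha : Summable a) (f : ZMod N → ℝ) :
    ∑ v, residueMass N a v * f v = ∑' h : ℤ, a h * f h := by
  simp only [residueMass, ← tsum_mul_right]
  rw [← Summable.tsum_finsetSum fun v _ => (summable_ite_residue ha v).mul_right _]
  refine tsum_congr fun h => ?_
  simp [ite_mul]

theorem residueMass_nonneg {a : ℤ → ℝ} (ha : ∀ h, 0 ≤ a h) (v : ZMod N) :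
    0 ≤ residueMass N a v :=
  tsum_nonneg fun h => by
    split_ifs
    · exact ha h
    · exact le_rfl

theorem residueMass_neg {a : ℤ → ℝ} (ha : ∀ h, a (-h) = a h) (v : ZMod N) :
    residueMass N a (-v) = residueMass N a v := by
  rw [residueMass, ← (Equiv.neg ℤ).tsum_eq, residueMass]
  refine tsum_congr fun h => ?_
  simp [ha]

/-- Only the integer frequency `0` is split off. The tail still charges the residue `0`, through the
nonzero multiples of `N`. -/
theorem residueMass_decay {α : ℝ} (hα : 1 / 2 < α) (γ : ℝ) (v : ZMod N) :
    residueMass N (decay α γ) v = (if v = 0 then 1 else 0) + residueMass N (decayTail α γ) v := by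
  have h0 : ∀ h : ℤ, h ≠ 0 → (if (h : ZMod N) = v then (if h = 0 then (1 : ℝ) else 0) else 0) = 0 :=
    fun h hh => by simp [hh]
  have h1 : ∑' h : ℤ, (if (h : ZMod N) = v then (if h = 0 then (1 : ℝ) else 0) else 0)
      = if v = 0 then 1 else 0 := by
    rw [tsum_eq_single 0 h0]
    simp [eq_comm]
  rw [← h1, residueMass, residueMass, ← Summable.tsum_add
    (summable_of_hasFiniteSupport ((Set.finite_singleton (0 : ℤ)).subset fun h hh => by
      by_contra hne
      exact hh (h0 h hne))) (summable_ite_residue (summable_decayTail hα γ) v)]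
  refine tsum_congr fun h => ?_
  rw [decay_eq_ite_add]
  split_ifs <;> simp

theorem residueMass_rpow_le {a : ℤ → ℝ} (ha : ∀ h, 0 ≤ a h) (hs : Summable a) {p : ℝ}
    (hp : 0 < p) (hp1 : p ≤ 1) (hs' : Summable fun h => a h ^ p) (v : ZMod N) :
    residueMass N a v ^ p ≤ residueMass N (fun h => a h ^ p) v := by
  have e : ∀ h : ℤ, (if (h : ZMod N) = v then a h else 0) ^ p
      = if (h : ZMod N) = v then a h ^ p else 0 := fun h => by
    split_ifs
    · rfl
    · exact Real.zero_rpow hp.ne'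
  have := rpow_tsum_le_tsum_rpow (f := fun h : ℤ => if (h : ZMod N) = v then a h else 0)
    (fun h => by split_ifs <;> simp [ha]) hp hp1 (summable_ite_residue hs v)
    (by simpa only [e] using summable_ite_residue hs' v)
  simpa only [e, residueMass] using this

theorem tsum_decayTail_mul {α : ℝ} (hα : 1 / 2 < α) (γ : ℝ) {f : ℤ → ℝ} {C : ℝ}
    (hf : ∀ h, |f h| ≤ C) :
    ∑' h : ℤ, decayTail α γ h * f h
      = γ * ∑' k : ℕ+, (k : ℝ) ^ (-(2 * α)) * (f (k : ℕ) + f (-(k : ℕ))) := by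
  have hs : Summable fun h : ℤ => decayTail α γ h * f h :=
    Summable.of_norm_bounded ((summable_decayTail hα γ).norm.mul_right C) fun h => by
      rw [norm_mul]
      exact mul_le_mul_of_nonneg_left (hf h) (norm_nonneg _)
  rw [tsum_int_eq_zero_add_tsum_pnat hs]
  have hs1 : Summable fun k : ℕ+ => decayTail α γ ((k : ℕ) : ℤ) * f ((k : ℕ) : ℤ) :=
    hs.comp_injective (i := fun k : ℕ+ => ((k : ℕ) : ℤ)) fun a b h => by simpa using h
  have hs2 : Summable fun k : ℕ+ => decayTail α γ (-((k : ℕ) : ℤ)) * f (-((k : ℕ) : ℤ)) :=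
    hs.comp_injective (i := fun k : ℕ+ => -((k : ℕ) : ℤ)) fun a b h => by simpa using h
  have h0 : decayTail α γ 0 * f 0 = 0 := by simp [decayTail]
  rw [h0, zero_add, ← hs1.tsum_add hs2, ← tsum_mul_left]
  refine tsum_congr fun k => ?_
  rw [decayTail_neg]
  simp [decayTail]
  ring

theorem tsum_decayTail {α : ℝ} (hα : 1 / 2 < α) (γ : ℝ) :
    ∑' h : ℤ, decayTail α γ h = 2 * γ * ∑' k : ℕ+, (k : ℝ) ^ (-(2 * α)) := by
  have := tsum_decayTail_mul hα γ (f := fun _ => 1) (C := 1) (by simp)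
  simp only [mul_one] at this
  rw [this, tsum_mul_right]
  ring

theorem sum_residueMass [NeZero N] {a : ℤ → ℝ} (ha : Summable a) : ∑ v, residueMass N a v = ∑' h, a h := by
  simpa using sum_residueMass_mul (N := N) ha fun _ => 1

theorem sum_residueMass_decay [NeZero N] {α : ℝ} (hα : 1 / 2 < α) (γ : ℝ) :
    ∑ v, residueMass N (decay α γ) v = 1 + 2 * γ * ∑' k : ℕ+, (k : ℝ) ^ (-(2 * α)) := by
  simp only [residueMass_decay hα, Finset.sum_add_distrib,
    sum_residueMass (summable_decayTail hα γ), tsum_decayTail hα]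
  simp

end ResidueMass

/-! ### The inductive component-by-component bound -/

section ComponentByComponent

variable {N : ℕ}

/-- The folded weights of the dual lattice. -/
def foldedDecay (N : ℕ) (α : ℝ) {d : ℕ} (γ : Fin d → ℝ) (j : Fin d) : ZMod N → ℝ :=
  residueMass N (decay α (γ j))

theorem foldedDecay_nonneg (α : ℝ) {d : ℕ} {γ : Fin d → ℝ} (hγ : ∀ j, 0 < γ j) (j : Fin d)
    (v : ZMod N) : 0 ≤ foldedDecay N α γ j v :=
  residueMass_nonneg (decay_nonneg α (hγ j)) v

theorem foldedDecay_neg (α : ℝ) {d : ℕ} (γ : Fin d → ℝ) (j : Fin d)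
    (v : ZMod N) : foldedDecay N α γ j (-v) = foldedDecay N α γ j v :=
  residueMass_neg (decay_neg α (γ j)) v

theorem foldedDecay_succ {α : ℝ} (hα : 1 / 2 < α) {d : ℕ} (γ : Fin (d + 1) → ℝ) :
    foldedDecay N α γ = Fin.snoc (α := fun _ => ZMod N → ℝ)
      (foldedDecay N α fun j : Fin d => γ j.castSucc)
      fun v => (if v = 0 then 1 else 0) + residueMass N (decayTail α (γ (Fin.last d))) v := by
  funext j
  refine Fin.lastCases ?_ (fun i => ?_) j
  · rw [Fin.snoc_last]
    exact funext fun v => residueMass_decay hα _ v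
  · rw [Fin.snoc_castSucc]
    rfl

/-- Some nonzero residue makes the increment of the dual sum small. -/
theorem exists_dualSum_snoc_le [NeZero N] (hN : 2 ≤ N) {α τ : ℝ} (hτ : 1 ≤ τ) (hτα : τ < 2 * α) {d : ℕ}
    {γ : Fin d → ℝ} (hγ : ∀ j, 0 < γ j) {γ' : ℝ} (hγ' : 0 < γ') (g : Fin d → ZMod N) :
    ∃ z : ZMod N, z ≠ 0 ∧
      dualSum (Fin.snoc (α := fun _ => ZMod N → ℝ) (foldedDecay N α γ)
        (residueMass N (decayTail α γ'))) (Fin.snoc (α := fun _ => ZMod N) g z) ^ (1 / τ)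
      ≤ 2 * (∑' k : ℕ+, (k : ℝ) ^ (-(2 * α / τ))) * γ' ^ (1 / τ) *
        (∏ j, (1 + 2 * (∑' k : ℕ+, (k : ℝ) ^ (-(2 * α / τ))) * γ j ^ (1 / τ))) / (N - 1) := by
  have hτ0 : 0 < τ := by linarith
  have hp : 0 < 1 / τ := by positivity
  have hp1 : 1 / τ ≤ 1 := (div_le_one hτ0).2 hτ
  have hα : 1 / 2 < α := by linarith
  -- Taking powers `1/τ` replaces `α` by `α/τ`; this is where `τ < 2α` keeps the weights summable.
  have hα' : 1 / 2 < α / τ := by rw [lt_div_iff₀ hτ0]; linarith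
  have ht : 1 < 2 * α / τ := by rw [lt_div_iff₀ hτ0]; linarith
  have e2 : 2 * (α / τ) = 2 * α / τ := by ring
  set S : Fin d → ZMod N → ℝ := foldedDecay N (α / τ) fun j => γ j ^ (1 / τ) with hS
  have hγp : ∀ j, 0 < γ j ^ (1 / τ) := fun j => Real.rpow_pos_of_pos (hγ j) _
  have hS0 : ∀ j v, 0 ≤ S j v := foldedDecay_nonneg _ hγp
  have hRS : ∀ j v, foldedDecay N α γ j v ^ (1 / τ) ≤ S j v := by
    intro j v
    have hs' : Summable fun h => decay α (γ j) h ^ (1 / τ) := by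
      simpa only [decay_rpow (hγ j) α hτ0] using summable_decay hα' (γ j ^ (1 / τ))
    have := residueMass_rpow_le (decay_nonneg α (hγ j)) (summable_decay hα _) hp hp1 hs' v
    simp only [decay_rpow (hγ j) α hτ0] at this
    exact this
  have hρσ : ∀ v : ZMod N, residueMass N (decayTail α γ') v ^ (1 / τ)
      ≤ residueMass N (decayTail (α / τ) (γ' ^ (1 / τ))) v := by
    intro v
    have hs' : Summable fun h => decayTail α γ' h ^ (1 / τ) := by
      simpa only [decayTail_rpow hγ' α hτ0] using summable_decayTail hα' (γ' ^ (1 / τ))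
    have := residueMass_rpow_le (decayTail_nonneg α hγ') (summable_decayTail hα _) hp hp1 hs' v
    simp only [decayTail_rpow hγ' α hτ0] at this
    exact this
  set W : ZMod N → ℝ := dualCosetSum S g with hW
  have hW0 : ∀ c, 0 ≤ W c := dualCosetSum_nonneg hS0 g
  have hWsum : ∑ c, W c
      = ∏ j, (1 + 2 * (∑' k : ℕ+, (k : ℝ) ^ (-(2 * α / τ))) * γ j ^ (1 / τ)) := by
    rw [hW, sum_dualCosetSum]
    refine Finset.prod_congr rfl fun j _ => ?_
    rw [hS, foldedDecay, sum_residueMass_decay hα', e2]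
    ring
  -- Symmetrizing `W` collects the frequencies `h` and `-h` into one sum over positive `h`. It
  -- doubles the total mass, hence the factor `2` in front of the zeta sum.
  obtain ⟨z, hz, hle⟩ := exists_ne_zero_tsum_le hN ht (W := fun c => W c + W (-c))
    fun c => add_nonneg (hW0 c) (hW0 _)
  refine ⟨z, hz, ?_⟩
  have hR0 : ∀ (j : Fin (d + 1)) v, 0 ≤ Fin.snoc (α := fun _ => ZMod N → ℝ) (foldedDecay N α γ)
        (residueMass N (decayTail α γ')) j v := by
    intro j v
    refine Fin.lastCases ?_ (fun i => ?_) j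
    · rw [Fin.snoc_last]
      exact residueMass_nonneg (decayTail_nonneg α hγ') v
    · rw [Fin.snoc_castSucc]
      exact foldedDecay_nonneg α hγ i v
  have hle2 : dualSum (fun j v => Fin.snoc (α := fun _ => ZMod N → ℝ) (foldedDecay N α γ)
        (residueMass N (decayTail α γ')) j v ^ (1 / τ)) (Fin.snoc (α := fun _ => ZMod N) g z)
      ≤ dualSum (Fin.snoc (α := fun _ => ZMod N → ℝ) S
        (residueMass N (decayTail (α / τ) (γ' ^ (1 / τ))))) (Fin.snoc (α := fun _ => ZMod N) g z) := by
    refine dualSum_mono (fun j v => Real.rpow_nonneg (hR0 j v) _) (fun j v => ?_) _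
    refine Fin.lastCases ?_ (fun i => ?_) j
    · simp only [Fin.snoc_last]
      exact hρσ v
    · simp only [Fin.snoc_castSucc]
      exact hRS i v
  refine (rpow_dualSum_le hR0 hp hp1 _).trans (hle2.trans ?_)
  rw [dualSum_snoc, sum_residueMass_mul (summable_decayTail hα' _) fun v => W (-(v * z)),
    tsum_decayTail_mul hα' _ (f := fun h : ℤ => W (-((h : ZMod N) * z))) (C := ∑ c, W c)
      (fun h => by
        rw [abs_of_nonneg (hW0 _)]
        exact Finset.single_le_sum (fun c _ => hW0 c) (Finset.mem_univ _)), e2]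
  have e3 : ∑' k : ℕ+, (k : ℝ) ^ (-(2 * α / τ)) * (W (-((((k : ℕ) : ℤ) : ZMod N) * z)) +
      W (-(((-((k : ℕ) : ℤ) : ℤ) : ZMod N) * z)))
      = ∑' k : ℕ+, (k : ℝ) ^ (-(2 * α / τ)) * (W ((k : ℕ) * z) + W (-((k : ℕ) * z))) := by
    refine tsum_congr fun k => ?_
    push_cast
    rw [neg_mul, neg_neg, add_comm (W (-_))]
  rw [e3]
  refine (mul_le_mul_of_nonneg_left hle (Real.rpow_nonneg hγ'.le _)).trans_eq ?_
  have hneg : ∑ c, W (-c) = ∑ c, W c := Equiv.sum_comp (Equiv.neg (ZMod N)) W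
  rw [Finset.sum_add_distrib, hneg, ← hWsum]
  ring

theorem eq_snoc_castLE {s d : ℕ} {β : Type*} (g : Fin s → β) (hd : d + 1 ≤ s) :
    (fun i => g (Fin.castLE hd i)) = Fin.snoc (α := fun _ => β)
      (fun i : Fin d => g (Fin.castLE (Nat.le_of_succ_le hd) i)) (g (Fin.castLE hd (Fin.last d))) := by
  funext j
  refine Fin.lastCases ?_ (fun i => ?_) j
  · rw [Fin.snoc_last]
  · rw [Fin.snoc_castSucc]
    rfl

/-- The component-by-component error bound, for any functional with the increments of the dual
sum or smaller. -/
theorem dual_bound_of_minimizer [NeZero N] (hN : 2 ≤ N) {α τ : ℝ} (hτ : 1 ≤ τ) (hτα : τ < 2 * α)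
    {D : (d : ℕ) → (Fin d → ZMod N → ℝ) → (Fin d → ZMod N) → ℝ}
    (hD0 : ∀ R g, D 0 R g = 1)
    (hDnonneg : ∀ d (R : Fin d → ZMod N → ℝ) g, (∀ j v, 0 ≤ R j v) → 0 ≤ D d R g)
    (hDle : ∀ d (R : Fin d → ZMod N → ℝ) g, (∀ j v, R j (-v) = R j v) → (∀ j v, 0 ≤ R j v) →
      D d R g ≤ dualSum R g)
    (hDsnoc : ∀ d (R : Fin d → ZMod N → ℝ) (ρ : ZMod N → ℝ) (g : Fin d → ZMod N) (z : ZMod N),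
      D (d + 1) (Fin.snoc (α := fun _ => ZMod N → ℝ) R fun v => (if v = 0 then 1 else 0) + ρ v)
          (Fin.snoc (α := fun _ => ZMod N) g z)
        = D d R g + D (d + 1) (Fin.snoc (α := fun _ => ZMod N → ℝ) R ρ)
          (Fin.snoc (α := fun _ => ZMod N) g z))
    {s : ℕ} {γ : Fin s → ℝ} (hγ : ∀ j, 0 < γ j) (g : Fin s → ZMod N)
    (hmin : ∀ (d : ℕ) (hd : d + 1 ≤ s) (z : ZMod N), z ≠ 0 →
      D (d + 1) (foldedDecay N α (firstWeights γ hd)) (fun i => g (Fin.castLE hd i)) ≤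
        D (d + 1) (foldedDecay N α (firstWeights γ hd)) (Fin.snoc (α := fun _ => ZMod N)
          (fun i : Fin d => g (Fin.castLE (Nat.le_of_succ_le hd) i)) z))
    (d : ℕ) (hd : d ≤ s) :
    1 ≤ D d (foldedDecay N α (firstWeights γ hd)) (fun i => g (Fin.castLE hd i)) ∧
      (D d (foldedDecay N α (firstWeights γ hd)) (fun i => g (Fin.castLE hd i)) - 1) ^ (1 / τ)
        ≤ (-1 + ∏ j : Fin d, (1 + 2 * (∑' k : ℕ+, (k : ℝ) ^ (-(2 * α / τ))) *
          firstWeights γ hd j ^ (1 / τ))) / (N - 1) := by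
  have hτ0 : 0 < τ := by linarith
  have hp : 0 < 1 / τ := by positivity
  have hp1 : 1 / τ ≤ 1 := (div_le_one hτ0).2 hτ
  have hα : 1 / 2 < α := by linarith
  induction d with
  | zero =>
    rw [hD0, sub_self, Real.zero_rpow hp.ne']
    simp
  | succ d ih =>
    obtain ⟨ih1, ih2⟩ := ih (Nat.le_of_succ_le hd)
    set γ₀ : Fin d → ℝ := firstWeights γ (Nat.le_of_succ_le hd) with hγ₀
    set γ' : ℝ := firstWeights γ hd (Fin.last d) with hγ'
    set g₀ : Fin d → ZMod N := fun i => g (Fin.castLE (Nat.le_of_succ_le hd) i) with hg₀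
    set ρ := residueMass N (decayTail α γ') with hρ
    set R := foldedDecay N α γ₀ with hR
    have hfold : foldedDecay N α (firstWeights γ hd) = Fin.snoc (α := fun _ => ZMod N → ℝ) R
        fun v => (if v = 0 then 1 else 0) + ρ v := foldedDecay_succ hα _
    have hR0 : ∀ (j : Fin (d + 1)) v, 0 ≤ Fin.snoc (α := fun _ => ZMod N → ℝ) R ρ j v := by
      intro j v
      refine Fin.lastCases ?_ (fun i => ?_) j
      · rw [Fin.snoc_last]
        exact residueMass_nonneg (decayTail_nonneg α (hγ _)) v
      · rw [Fin.snoc_castSucc]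
        exact foldedDecay_nonneg α (fun j => hγ _) i v
    have hReven : ∀ (j : Fin (d + 1)) v, Fin.snoc (α := fun _ => ZMod N → ℝ) R ρ j (-v)
        = Fin.snoc (α := fun _ => ZMod N → ℝ) R ρ j v := by
      intro j v
      refine Fin.lastCases ?_ (fun i => ?_) j
      · rw [Fin.snoc_last]
        exact residueMass_neg (decayTail_neg α γ') v
      · rw [Fin.snoc_castSucc]
        exact foldedDecay_neg α γ₀ i v
    obtain ⟨z, hz, hle⟩ := exists_dualSum_snoc_le hN hτ hτα (γ := γ₀) (fun j => hγ _)
      (γ' := γ') (hγ _) g₀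
    -- The minimizing component is compared with the good residue `z`. The value at `z` is the
    -- previous value plus `θ`, and `θ` is bounded by the increment of `dualSum`.
    have hmin' := hmin d hd z hz
    rw [hfold, hDsnoc] at hmin'
    set θ := D (d + 1) (Fin.snoc (α := fun _ => ZMod N → ℝ) R ρ)
      (Fin.snoc (α := fun _ => ZMod N) g₀ z) with hθ
    have hθ0 : 0 ≤ θ := hDnonneg _ _ _ hR0
    have hθle := (Real.rpow_le_rpow hθ0 (hDle _ _ _ hReven hR0) hp.le).trans hle
    rw [hfold]
    have hone : 1 ≤ D (d + 1) (Fin.snoc (α := fun _ => ZMod N → ℝ) R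
        fun v => (if v = 0 then 1 else 0) + ρ v) fun i => g (Fin.castLE hd i) := by
      rw [eq_snoc_castLE g hd, hDsnoc]
      exact ih1.trans (le_add_of_nonneg_right (hDnonneg _ _ _ hR0))
    refine ⟨hone, ?_⟩
    -- Subadditivity of the power `1/τ` separates old error and increment. The two bounds then
    -- telescope: `(P - 1) + c P = (1 + c) P - 1` for the product `P` and the new factor `1 + c`.
    calc _ ≤ ((D d R g₀ - 1) + θ) ^ (1 / τ) :=
          Real.rpow_le_rpow (by linarith) (by linarith) hp.le
      _ ≤ (D d R g₀ - 1) ^ (1 / τ) + θ ^ (1 / τ) :=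
          Real.rpow_add_le_add_rpow (by linarith) hθ0 hp.le hp1
      _ ≤ _ := add_le_add ih2 hθle
      _ = _ := by
          rw [Fin.prod_univ_castSucc, ← add_div]
          congr 1
          have e : ∀ j : Fin d, firstWeights γ hd j.castSucc = γ₀ j := fun j => rfl
          simp only [e, ← hγ']
          ring

end ComponentByComponent

/-! ### Continuity and normalization of the kernels -/

section Kernels

theorem abs_cos_mul_cos_add_sin_mul_sin_le (a b : ℝ) :
    |Real.cos a * Real.cos b + Real.sin a * Real.sin b| ≤ 1 := by
  rw [← Real.cos_sub]
  exact Real.abs_cos_le_one _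

theorem continuous_korobovKernel₁ {α : ℝ} (hα : 1 / 2 < α) {γ : ℝ} (hγ : 0 < γ) :
    Continuous fun p : I × I => korobovKernel₁ α γ p.1 p.2 := by
  simp only [(korobovKernel₁_eq hα hγ _ _).2]
  refine continuous_tsum (fun h => by fun_prop) (summable_decay hα γ) fun h p => ?_
  rw [norm_mul, Real.norm_of_nonneg (decay_nonneg α hγ h)]
  exact mul_le_of_le_one_right (decay_nonneg α hγ h) (abs_cos_mul_cos_add_sin_mul_sin_le _ _)

theorem summable_decay_natCast_add_one {α : ℝ} (hα : 1 / 2 < α) (γ : ℝ) :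
    Summable fun k : ℕ => decay α γ ((k : ℤ) + 1) :=
  (summable_decay hα γ).comp_injective (i := fun k : ℕ => (k : ℤ) + 1) fun a b h => by simpa using h

theorem sqrt_two_mul_mul_sqrt_two_mul (r a b : ℝ) : r * (√2 * a) * (√2 * b) = r * 2 * (a * b) := by
  have h2 : √2 * √2 = (2 : ℝ) := Real.mul_self_sqrt (by norm_num)
  linear_combination r * a * b * h2

theorem norm_cosineTerm_le {α : ℝ} {γ : ℝ} (hγ : 0 < γ) (k : ℕ) (a b : ℝ) :
    ‖decay α γ ((k : ℤ) + 1) * (√2 * Real.cos a) * (√2 * Real.cos b)‖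
      ≤ decay α γ ((k : ℤ) + 1) * 2 := by
  have h3 : 0 ≤ decay α γ ((k : ℤ) + 1) * 2 := mul_nonneg (decay_nonneg α hγ _) (by norm_num)
  rw [sqrt_two_mul_mul_sqrt_two_mul, norm_mul, Real.norm_of_nonneg h3, norm_mul]
  exact mul_le_of_le_one_right h3
    (mul_le_one₀ (Real.abs_cos_le_one _) (norm_nonneg _) (Real.abs_cos_le_one _))

theorem continuous_cosineKernel₁ {α : ℝ} (hα : 1 / 2 < α) {γ : ℝ} (hγ : 0 < γ) :
    Continuous fun p : I × I => cosineKernel₁ α γ p.1 p.2 := by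
  unfold cosineKernel₁
  refine continuous_const.add (continuous_tsum (fun k => by fun_prop)
    ((summable_decay_natCast_add_one hα γ).mul_right 2) fun k p => norm_cosineTerm_le hγ k _ _)

theorem continuous_korobovKernel₁_comp {α : ℝ} (hα : 1 / 2 < α) {γ : ℝ} (hγ : 0 < γ) {Y : Type*}
    [TopologicalSpace Y] {f g : Y → I} (hf : Continuous f) (hg : Continuous g) :
    Continuous fun y => korobovKernel₁ α γ (f y) (g y) :=
  Continuous.comp (g := fun p : I × I => korobovKernel₁ α γ p.1 p.2) (f := fun y => (f y, g y))
    (continuous_korobovKernel₁ hα hγ) (hf.prodMk hg)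

theorem continuous_cosineKernel₁_comp {α : ℝ} (hα : 1 / 2 < α) {γ : ℝ} (hγ : 0 < γ) {Y : Type*}
    [TopologicalSpace Y] {f g : Y → I} (hf : Continuous f) (hg : Continuous g) :
    Continuous fun y => cosineKernel₁ α γ (f y) (g y) :=
  Continuous.comp (g := fun p : I × I => cosineKernel₁ α γ p.1 p.2) (f := fun y => (f y, g y))
    (continuous_cosineKernel₁ hα hγ) (hf.prodMk hg)

theorem integral_unitInterval_eq (f : ℝ → ℝ) : ∫ x : I, f x = ∫ x in (0 : ℝ)..1, f x := by
  rw [intervalIntegral.integral_of_le zero_le_one, ← integral_Icc_eq_integral_Ioc]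
  exact integral_subtype measurableSet_Icc f

theorem integral_cos_mul {a : ℝ} (ha : a ≠ 0) : ∫ x : I, Real.cos (a * x) = Real.sin a / a := by
  rw [integral_unitInterval_eq fun x => Real.cos (a * x),
    intervalIntegral.integral_comp_mul_left _ ha]
  simp [integral_cos]
  ring

theorem integral_sin_mul {a : ℝ} (ha : a ≠ 0) :
    ∫ x : I, Real.sin (a * x) = (1 - Real.cos a) / a := by
  rw [integral_unitInterval_eq fun x => Real.sin (a * x),
    intervalIntegral.integral_comp_mul_left _ ha]
  simp [integral_sin]
  ring

theorem integrable_of_continuous {f : I → ℝ} (hf : Continuous f) : Integrable f :=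
  hf.integrable_of_hasCompactSupport (HasCompactSupport.of_compactSpace _)

theorem integral_tsum_of_norm_le {ι : Type*} [Countable ι] {F : ι → I → ℝ} {b : ι → ℝ}
    (hF : ∀ i, Continuous (F i)) (hb : Summable b) (h : ∀ i x, ‖F i x‖ ≤ b i) :
    ∫ x, ∑' i, F i x = ∑' i, ∫ x, F i x := by
  refine (integral_tsum_of_summable_integral_norm (fun i => integrable_of_continuous (hF i))
    (Summable.of_nonneg_of_le (fun i => integral_nonneg fun x => norm_nonneg _) (fun i => ?_)
      hb)).symm
  calc ∫ x, ‖F i x‖ ≤ ∫ _x : I, b i :=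
        integral_mono (integrable_of_continuous (hF i).norm) (integrable_const _) (h i)
    _ = b i := by simp

theorem integral_korobovKernel₁ {α : ℝ} (hα : 1 / 2 < α) {γ : ℝ} (hγ : 0 < γ) (y : I) :
    ∫ x, korobovKernel₁ α γ x y = 1 := by
  simp only [(korobovKernel₁_eq hα hγ _ _).2]
  rw [integral_tsum_of_norm_le (b := decay α γ) (fun h => by fun_prop) (summable_decay hα γ)
    fun h x => ?_]
  · rw [tsum_eq_single 0 fun h hh => ?_]
    · simp [decay]
    · have ha : 2 * Real.pi * (h : ℝ) ≠ 0 := by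
        have : (h : ℝ) ≠ 0 := Int.cast_ne_zero.2 hh
        positivity
      have hc : Real.cos (2 * Real.pi * (h : ℝ)) = 1 := by
        rw [mul_comm]
        exact Real.cos_int_mul_two_pi h
      have hs : Real.sin (2 * Real.pi * (h : ℝ)) = 0 := by
        have := Real.sin_int_mul_pi (2 * h)
        push_cast at this
        rw [← this]
        congr 1
        ring
      rw [integral_const_mul, integral_add (integrable_of_continuous (by fun_prop))
        (integrable_of_continuous (by fun_prop)), integral_mul_const, integral_mul_const,
        integral_cos_mul ha, integral_sin_mul ha, hc, hs]
      simp
  · rw [norm_mul, Real.norm_of_nonneg (decay_nonneg α hγ h)]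
    exact mul_le_of_le_one_right (decay_nonneg α hγ h) (abs_cos_mul_cos_add_sin_mul_sin_le _ _)

theorem integral_cosineKernel₁ {α : ℝ} (hα : 1 / 2 < α) {γ : ℝ} (hγ : 0 < γ) (y : I) :
    ∫ x, cosineKernel₁ α γ x y = 1 := by
  have hcont : Continuous fun x : I => cosineKernel₁ α γ x y :=
    continuous_cosineKernel₁_comp hα hγ continuous_id continuous_const
  have hint : ∫ x : I, ∑' k : ℕ, decay α γ ((k : ℤ) + 1) *
      (√2 * Real.cos (Real.pi * ((k : ℝ) + 1) * x)) *
        (√2 * Real.cos (Real.pi * ((k : ℝ) + 1) * y)) = 0 := by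
    rw [integral_tsum_of_norm_le (fun k => by fun_prop)
      ((summable_decay_natCast_add_one hα γ).mul_right 2) fun k x => norm_cosineTerm_le hγ k _ _]
    refine (tsum_congr fun k => ?_).trans tsum_zero
    have ha : Real.pi * ((k : ℝ) + 1) ≠ 0 := by positivity
    have hs : Real.sin (Real.pi * ((k : ℝ) + 1)) = 0 := by
      have := Real.sin_nat_mul_pi (k + 1)
      push_cast at this
      rw [mul_comm, this]
    rw [integral_mul_const, integral_const_mul, integral_const_mul, integral_cos_mul ha, hs]
    simp
  have hcont' : Continuous fun x : I => ∑' k : ℕ, decay α γ ((k : ℤ) + 1) *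
      (√2 * Real.cos (Real.pi * ((k : ℝ) + 1) * x)) *
        (√2 * Real.cos (Real.pi * ((k : ℝ) + 1) * y)) := by
    refine (hcont.sub (continuous_const (y := (1 : ℝ)))).congr fun x => ?_
    simp [cosineKernel₁]
  unfold cosineKernel₁
  rw [integral_add (integrable_const _) (integrable_of_continuous hcont'), hint]
  simp

variable {α : ℝ} {d : ℕ} {γ : Fin d → ℝ}

theorem continuous_korobovKernel (hα : 1 / 2 < α) (hγ : ∀ j, 0 < γ j) :
    Continuous fun p : (Fin d → I) × (Fin d → I) => korobovKernel α γ p.1 p.2 := by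
  unfold korobovKernel
  refine continuous_finsetProd _ fun j _ => ?_
  exact continuous_korobovKernel₁_comp hα (hγ j)
    ((continuous_apply j).comp continuous_fst) ((continuous_apply j).comp continuous_snd)

theorem continuous_korCosKernel (hα : 1 / 2 < α) (hγ : ∀ j, 0 < γ j) :
    Continuous fun p : (Fin d → I) × (Fin d → I) => korCosKernel α γ p.1 p.2 := by
  unfold korCosKernel
  refine continuous_finsetProd _ fun j _ => continuous_const.mul (Continuous.add ?_ ?_)
  · exact continuous_korobovKernel₁_comp hα (hγ j)
      ((continuous_apply j).comp continuous_fst) ((continuous_apply j).comp continuous_snd)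
  · exact continuous_cosineKernel₁_comp hα (hγ j)
      ((continuous_apply j).comp continuous_fst) ((continuous_apply j).comp continuous_snd)

theorem integral_korobovKernel (hα : 1 / 2 < α) (hγ : ∀ j, 0 < γ j) (y : Fin d → I) :
    ∫ x, korobovKernel α γ x y = 1 := by
  unfold korobovKernel
  rw [integral_fintype_prod_volume_eq_prod fun j (t : I) => korobovKernel₁ α (γ j) t (y j)]
  exact Finset.prod_eq_one fun j _ => integral_korobovKernel₁ hα (hγ j) _

theorem integral_korCosKernel (hα : 1 / 2 < α) (hγ : ∀ j, 0 < γ j) (y : Fin d → I) :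
    ∫ x, korCosKernel α γ x y = 1 := by
  unfold korCosKernel
  rw [integral_fintype_prod_volume_eq_prod fun j (t : I) =>
    (1 / 2) * (korobovKernel₁ α (γ j) t (y j) + cosineKernel₁ α (γ j) t (y j))]
  refine Finset.prod_eq_one fun j _ => ?_
  have h1 : Continuous fun t : I => korobovKernel₁ α (γ j) t (y j) :=
    continuous_korobovKernel₁_comp hα (hγ j) continuous_id continuous_const
  have h2 : Continuous fun t : I => cosineKernel₁ α (γ j) t (y j) :=
    continuous_cosineKernel₁_comp hα (hγ j) continuous_id continuous_const
  rw [integral_const_mul, integral_add (integrable_of_continuous h1) (integrable_of_continuous h2),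
    integral_korobovKernel₁ hα (hγ j), integral_cosineKernel₁ hα (hγ j)]
  norm_num

theorem worstCaseError_korobovSpace [h : Fact (Admissible α γ)] {ι : Type*} [Fintype ι]
    [Nonempty ι] (p : ι → Fin d → I) :
    worstCaseError (KorobovSpace α γ) p = ENNReal.ofReal
      √(-1 + (1 / (Fintype.card ι : ℝ)) ^ 2 * ∑ i, ∑ j, korobovKernel α γ (p i) (p j)) :=
  worstCaseError_eq RKHS.OfKernel.kernel_ofKernel
    (continuous_korobovKernel h.out.half_lt h.out.weight_pos)
    (integral_korobovKernel h.out.half_lt h.out.weight_pos) p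

theorem worstCaseError_korCosSpace [h : Fact (Admissible α γ)] {ι : Type*} [Fintype ι]
    [Nonempty ι] (p : ι → Fin d → I) :
    worstCaseError (KorCosSpace α γ) p = ENNReal.ofReal
      √(-1 + (1 / (Fintype.card ι : ℝ)) ^ 2 * ∑ i, ∑ j, korCosKernel α γ (p i) (p j)) :=
  worstCaseError_eq RKHS.OfKernel.kernel_ofKernel
    (continuous_korCosKernel h.out.half_lt h.out.weight_pos)
    (integral_korCosKernel h.out.half_lt h.out.weight_pos) p

end Kernels

/-! ### The errors of the two rules as dual sums -/

section LatticeEvaluation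

/-- The decay of the symmetrized kernel: the mean of `γ` and `2^{-2α} γ`. -/
def symWeight (α γ : ℝ) : ℝ := γ * (1 + 2 ^ (-2 * α)) / 2

theorem symWeight_pos (α : ℝ) {γ : ℝ} (hγ : 0 < γ) : 0 < symWeight α γ := by
  unfold symWeight
  positivity

theorem symWeight_le {α : ℝ} (hα : 1 / 2 < α) {γ : ℝ} (hγ : 0 < γ) : symWeight α γ ≤ γ := by
  have h : (2 : ℝ) ^ (-2 * α) ≤ 1 :=
    Real.rpow_le_one_of_one_le_of_nonpos (by norm_num) (by linarith)
  unfold symWeight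
  nlinarith

theorem cos_two_pi_mul_symm (h : ℤ) (x : I) :
    Real.cos (2 * Real.pi * h * (unitInterval.symm x : I)) = Real.cos (2 * Real.pi * h * x) := by
  have e : 2 * Real.pi * h * ((unitInterval.symm x : I) : ℝ)
      = h * (2 * Real.pi) - 2 * Real.pi * h * x := by
    rw [unitInterval.coe_symm_eq]
    ring
  rw [e, Real.cos_int_mul_two_pi_sub]

theorem sin_two_pi_mul_symm (h : ℤ) (x : I) :
    Real.sin (2 * Real.pi * h * (unitInterval.symm x : I)) = -Real.sin (2 * Real.pi * h * x) := by
  have e : 2 * Real.pi * h * ((unitInterval.symm x : I) : ℝ)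
      = h * (2 * Real.pi) - 2 * Real.pi * h * x := by
    rw [unitInterval.coe_symm_eq]
    ring
  rw [e, Real.sin_int_mul_two_pi_sub]

theorem cos_pi_mul_symm (k : ℕ) (x : I) :
    Real.cos (Real.pi * ((k : ℝ) + 1) * (unitInterval.symm x : I))
      = (-1) ^ (k + 1) * Real.cos (Real.pi * ((k : ℝ) + 1) * x) := by
  have e : Real.pi * ((k : ℝ) + 1) * ((unitInterval.symm x : I) : ℝ)
      = (k + 1 : ℕ) * Real.pi - Real.pi * ((k : ℝ) + 1) * x := by
    rw [unitInterval.coe_symm_eq]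
    push_cast
    ring
  rw [e, Real.cos_nat_mul_pi_sub]

theorem korobovKernel₁_symm_symm {α : ℝ} (hα : 1 / 2 < α) {γ : ℝ} (hγ : 0 < γ) (x y : I) :
    korobovKernel₁ α γ (unitInterval.symm x) (unitInterval.symm y) = korobovKernel₁ α γ x y := by
  rw [(korobovKernel₁_eq hα hγ _ _).2, (korobovKernel₁_eq hα hγ _ _).2]
  simp only [cos_two_pi_mul_symm, sin_two_pi_mul_symm, neg_mul_neg]

theorem cosineKernel₁_symm_symm (α γ : ℝ) (x y : I) :
    cosineKernel₁ α γ (unitInterval.symm x) (unitInterval.symm y) = cosineKernel₁ α γ x y := by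
  unfold cosineKernel₁
  congr 1
  refine tsum_congr fun k => ?_
  rw [sqrt_two_mul_mul_sqrt_two_mul, sqrt_two_mul_mul_sqrt_two_mul, cos_pi_mul_symm,
    cos_pi_mul_symm]
  have : ((-1 : ℝ) ^ (k + 1)) * (-1) ^ (k + 1) = 1 := by
    rw [← mul_pow]
    simp
  linear_combination (decay α γ ((k : ℤ) + 1) * 2 * Real.cos (Real.pi * ((k : ℝ) + 1) * x) *
    Real.cos (Real.pi * ((k : ℝ) + 1) * y)) * this

/-- Reflection fixes the cosines of integer frequency and changes the sign of the sines, which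
therefore cancel. -/
theorem korobovKernel₁_add_symm {α : ℝ} (hα : 1 / 2 < α) {γ : ℝ} (hγ : 0 < γ) (x y : I) :
    korobovKernel₁ α γ x y + korobovKernel₁ α γ (unitInterval.symm x) y
      = 2 * ∑' h : ℤ, decay α γ h *
        (Real.cos (2 * Real.pi * h * x) * Real.cos (2 * Real.pi * h * y)) := by
  obtain ⟨hs1, he1⟩ := korobovKernel₁_eq hα hγ x y
  obtain ⟨hs2, he2⟩ := korobovKernel₁_eq hα hγ (unitInterval.symm x) y
  rw [he1, he2, ← hs1.tsum_add hs2, ← tsum_mul_left]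
  refine tsum_congr fun h => ?_
  rw [cos_two_pi_mul_symm, sin_two_pi_mul_symm]
  ring

theorem abs_cos_mul_cos_le_one (a b : ℝ) : |Real.cos a * Real.cos b| ≤ 1 := by
  rw [abs_mul]
  exact mul_le_one₀ (Real.abs_cos_le_one _) (abs_nonneg _) (Real.abs_cos_le_one _)

theorem tsum_decay_mul_cos {α : ℝ} (hα : 1 / 2 < α) {γ : ℝ} (hγ : 0 < γ) (x y : ℝ) :
    ∑' h : ℤ, decay α γ h * (Real.cos (2 * Real.pi * h * x) * Real.cos (2 * Real.pi * h * y))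
      = 1 + γ * (2 * ∑' k : ℕ+, (k : ℝ) ^ (-(2 * α)) *
        (Real.cos (2 * Real.pi * k * x) * Real.cos (2 * Real.pi * k * y))) := by
  have h0 : ∀ h : ℤ, decay α γ h *
      (Real.cos (2 * Real.pi * h * x) * Real.cos (2 * Real.pi * h * y))
      = (if h = 0 then 1 else 0) + decayTail α γ h *
      (Real.cos (2 * Real.pi * h * x) * Real.cos (2 * Real.pi * h * y)) := by
    intro h
    rw [decay_eq_ite_add, add_mul]
    congr 1
    split_ifs with hh <;> simp [hh]
  have hs : Summable fun h : ℤ => decayTail α γ h *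
      (Real.cos (2 * Real.pi * h * x) * Real.cos (2 * Real.pi * h * y)) :=
    Summable.of_norm_bounded (summable_decayTail hα γ) fun h => by
      rw [norm_mul, Real.norm_of_nonneg (decayTail_nonneg α hγ h)]
      exact mul_le_of_le_one_right (decayTail_nonneg α hγ h) (abs_cos_mul_cos_le_one _ _)
  simp only [h0]
  rw [Summable.tsum_add (summable_of_hasFiniteSupport
    ((Set.finite_singleton (0 : ℤ)).subset fun h hh => by
      by_contra hne
      exact hh (if_neg hne))) hs, tsum_ite_eq,
    tsum_decayTail_mul hα γ (f := fun h : ℤ =>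
      Real.cos (2 * Real.pi * h * x) * Real.cos (2 * Real.pi * h * y)) (C := 1)
      fun h => abs_cos_mul_cos_le_one _ _, ← tsum_mul_left (a := (2 : ℝ))]
  congr 2
  refine tsum_congr fun k => ?_
  push_cast
  rw [mul_neg, neg_mul, neg_mul, Real.cos_neg, Real.cos_neg]
  ring

/-- Reflection multiplies `cos (π k x)` by `(-1)^k`, so odd `k` cancel. An even `k = 2m` gives `cos
(2π m x)` with coefficient `γ (2m)^(-2α)`. The survivors thus have Korobov frequencies with weight
`γ 2^(-2α)`. -/
theorem cosineKernel₁_add_symm {α : ℝ} (hα : 1 / 2 < α) {γ : ℝ} (hγ : 0 < γ) (x y : I) :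
    cosineKernel₁ α γ x y + cosineKernel₁ α γ (unitInterval.symm x) y
      = 2 * ∑' h : ℤ, decay α (γ * 2 ^ (-2 * α)) h *
        (Real.cos (2 * Real.pi * h * x) * Real.cos (2 * Real.pi * h * y)) := by
  have hs : ∀ z : I, Summable fun k : ℕ => decay α γ ((k : ℤ) + 1) *
      (√2 * Real.cos (Real.pi * ((k : ℝ) + 1) * z)) *
        (√2 * Real.cos (Real.pi * ((k : ℝ) + 1) * y)) := fun z =>
    Summable.of_norm_bounded ((summable_decay_natCast_add_one hα γ).mul_right 2) fun k =>
      norm_cosineTerm_le hγ k _ _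
  rw [tsum_decay_mul_cos hα (by positivity)]
  set G : ℕ → ℝ := fun k => decay α γ ((k : ℤ) + 1) * 2 * (1 + (-1) ^ (k + 1)) *
    (Real.cos (Real.pi * ((k : ℝ) + 1) * x) * Real.cos (Real.pi * ((k : ℝ) + 1) * y)) with hG
  have h1 : cosineKernel₁ α γ x y + cosineKernel₁ α γ (unitInterval.symm x) y
      = 2 + ∑' k, G k := by
    unfold cosineKernel₁
    rw [add_add_add_comm, ← (hs x).tsum_add (hs _)]
    congr 1
    · norm_num
    · refine tsum_congr fun k => ?_
      rw [sqrt_two_mul_mul_sqrt_two_mul, sqrt_two_mul_mul_sqrt_two_mul, cos_pi_mul_symm, hG]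
      ring
  have hinj : Function.Injective fun k : ℕ+ => 2 * (k : ℕ) - 1 := by
    intro a b hab
    have ha := a.pos
    have hb := b.pos
    have : 2 * (a : ℕ) - 1 = 2 * (b : ℕ) - 1 := hab
    exact PNat.coe_injective (by omega)
  -- The index `k` stands for the frequency `k + 1`, so the even frequencies `2m` sit at the indices
  -- `2m - 1`.
  have hsupp : Function.support G ⊆ Set.range fun k : ℕ+ => 2 * (k : ℕ) - 1 := by
    intro n hn
    rcases Nat.even_or_odd' n with ⟨m, rfl | rfl⟩
    · refine absurd ?_ hn
      have : (-1 : ℝ) ^ (2 * m + 1) = -1 := by simp [pow_succ, pow_mul]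
      simp [hG, this]
    · exact ⟨⟨m + 1, by omega⟩, by simp; omega⟩
  rw [h1, ← hinj.tsum_eq hsupp, mul_add, mul_one]
  congr 1
  rw [← tsum_mul_left, ← tsum_mul_left, ← tsum_mul_left]
  refine tsum_congr fun k => ?_
  have hk : 1 ≤ 2 * (k : ℕ) := by have := k.pos; omega
  have hpow : (-1 : ℝ) ^ (2 * (k : ℕ) - 1 + 1) = 1 := by
    rw [Nat.sub_add_cancel hk]
    simp
  have hcast : (((2 * (k : ℕ) - 1 : ℕ) : ℤ) + 1) = 2 * (k : ℕ) := by omega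
  have hcast' : (((2 * (k : ℕ) - 1 : ℕ) : ℝ) + 1) = 2 * (k : ℕ) := by exact_mod_cast hcast
  have hne : (2 * ((k : ℕ) : ℤ)) ≠ 0 := by have := k.pos; omega
  have hdecay : decay α γ (2 * ((k : ℕ) : ℤ)) = γ * 2 ^ (-2 * α) * (k : ℝ) ^ (-(2 * α)) := by
    rw [decay, if_neg hne]
    push_cast
    rw [abs_of_nonneg (by positivity), Real.mul_rpow (by norm_num) (by positivity), neg_mul]
    ring
  simp only [hG, hpow, hcast, hcast', hdecay]
  have e : ∀ z : ℝ, Real.pi * (2 * ((k : ℕ) : ℝ)) * z = 2 * Real.pi * k * z := fun z => by ring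
  rw [e, e]
  ring

/-- The one-dimensional factor of the kernel of the sum space. -/
def korCosKernel₁ (α γ : ℝ) (x y : I) : ℝ :=
  (1 / 2) * (korobovKernel₁ α γ x y + cosineKernel₁ α γ x y)

theorem korCosKernel₁_symm_symm {α : ℝ} (hα : 1 / 2 < α) {γ : ℝ} (hγ : 0 < γ) (x y : I) :
    korCosKernel₁ α γ (unitInterval.symm x) (unitInterval.symm y) = korCosKernel₁ α γ x y := by
  rw [korCosKernel₁, korobovKernel₁_symm_symm hα hγ, cosineKernel₁_symm_symm, korCosKernel₁]

theorem korCosKernel₁_add_symm {α : ℝ} (hα : 1 / 2 < α) {γ : ℝ} (hγ : 0 < γ) (x y : I) :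
    korCosKernel₁ α γ x y + korCosKernel₁ α γ (unitInterval.symm x) y
      = 2 * ∑' h : ℤ, decay α (symWeight α γ) h *
        (Real.cos (2 * Real.pi * h * x) * Real.cos (2 * Real.pi * h * y)) := by
  have h1 := korobovKernel₁_add_symm hα hγ x y
  have h2 := cosineKernel₁_add_symm hα hγ x y
  rw [tsum_decay_mul_cos hα hγ] at h1
  rw [tsum_decay_mul_cos hα (by positivity)] at h2
  rw [tsum_decay_mul_cos hα (symWeight_pos α hγ), korCosKernel₁, korCosKernel₁, symWeight]
  linear_combination (1 / 2) * h1 + (1 / 2) * h2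

theorem sum_finset_prod_ite {d : ℕ} (f g : Fin d → ℝ) :
    ∑ u : Finset (Fin d), ∏ j, (if j ∈ u then f j else g j) = ∏ j, (f j + g j) := by
  rw [Finset.prod_add, Finset.powerset_univ]
  refine Finset.sum_congr rfl fun u _ => ?_
  rw [Finset.prod_ite]
  congr 1
  · congr 1
    ext
    simp
  · congr 1
    ext
    simp

/-- Reflecting both arguments of a factor changes nothing, so the sum over `w` is the same for every
`u`. This gives `2^d` from the choice of `u` and another `2^d` from the factor `2` in
`korCosKernel₁_add_symm`. -/
theorem sum_sum_korCosKernel_symPoint {α : ℝ} (hα : 1 / 2 < α) {d : ℕ} {γ : Fin d → ℝ}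
    (hγ : ∀ j, 0 < γ j) (x y : Fin d → I) :
    ∑ u : Finset (Fin d), ∑ w : Finset (Fin d), korCosKernel α γ (symPoint u x) (symPoint w y)
      = 4 ^ d * ∏ j, ∑' h : ℤ, decay α (symWeight α (γ j)) h *
        (Real.cos (2 * Real.pi * h * x j) * Real.cos (2 * Real.pi * h * y j)) := by
  have h1 : ∀ u : Finset (Fin d),
      ∑ w : Finset (Fin d), korCosKernel α γ (symPoint u x) (symPoint w y)
      = ∏ j, (korCosKernel₁ α (γ j) (x j) (y j)
        + korCosKernel₁ α (γ j) (unitInterval.symm (x j)) (y j)) := by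
    intro u
    have h2 : ∀ w : Finset (Fin d), korCosKernel α γ (symPoint u x) (symPoint w y)
        = ∏ j, if j ∈ w then
            korCosKernel₁ α (γ j) (symPoint u x j) (unitInterval.symm (y j))
          else korCosKernel₁ α (γ j) (symPoint u x j) (y j) := by
      intro w
      refine Finset.prod_congr rfl fun j _ => ?_
      by_cases hj : j ∈ w <;> simp [symPoint, hj, korCosKernel₁]
    simp only [h2]
    rw [sum_finset_prod_ite]
    refine Finset.prod_congr rfl fun j _ => ?_
    have h3 := korCosKernel₁_symm_symm hα (hγ j) (x j) (y j)
    have h4 := korCosKernel₁_symm_symm hα (hγ j) (unitInterval.symm (x j)) (y j)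
    rw [unitInterval.symm_symm] at h4
    by_cases hj : j ∈ u
    · simp [symPoint, hj, h3]
    · simp [symPoint, hj, h4, add_comm]
  simp only [h1, korCosKernel₁_add_symm hα (hγ _)]
  rw [Finset.prod_mul_distrib, Finset.sum_const, Finset.card_univ, Fintype.card_finset,
    Fintype.card_fin, Finset.prod_const, Finset.card_univ, Fintype.card_fin, nsmul_eq_mul,
    ← mul_assoc]
  push_cast
  rw [← mul_pow]
  norm_num

variable {N : ℕ} [NeZero N]

theorem cos_latticePoint (h : ℤ) {d : ℕ} (g : Fin d → ℕ) (n : Fin N) (j : Fin d) :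
    Real.cos (2 * Real.pi * h * (latticePoint N g n j : I))
      = residueCos (((n : ℕ) : ZMod N) * ((h : ZMod N) * (g j : ZMod N))) := by
  have e1 : (((n : ℕ) : ZMod N) * ((h : ZMod N) * (g j : ZMod N)))
      = (((n : ℕ) * (h * g j) : ℤ) : ZMod N) := by push_cast; rfl
  rw [e1, residueCos_intCast]
  -- Passing to the fractional part subtracts an integer, which times `2π h` is a period.
  have e2 : 2 * Real.pi * h * ((latticePoint N g n j : I) : ℝ)
      = 2 * Real.pi * (((n : ℕ) * (h * g j) : ℤ) : ℝ) / N
        - ((h * ⌊((n : ℕ) : ℝ) * g j / N⌋ : ℤ) : ℝ) * (2 * Real.pi) := by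
    simp only [latticePoint, Int.fract]
    push_cast
    ring
  rw [e2, Real.cos_sub_int_mul_two_pi]

theorem cos_sub_latticePoint (h : ℤ) {d : ℕ} (g : Fin d → ℕ) (n m : Fin N) (j : Fin d) :
    Real.cos (2 * Real.pi * h * (latticePoint N g n j : I)
        - 2 * Real.pi * h * (latticePoint N g m j : I))
      = residueCos ((((n : ℕ) : ZMod N) - ((m : ℕ) : ZMod N)) *
        ((h : ZMod N) * (g j : ZMod N))) := by
  have e1 : ((((n : ℕ) : ZMod N) - ((m : ℕ) : ZMod N)) * ((h : ZMod N) * (g j : ZMod N)))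
      = ((((n : ℕ) - (m : ℕ)) * (h * g j) : ℤ) : ZMod N) := by push_cast; rfl
  rw [e1, residueCos_intCast]
  have e2 : 2 * Real.pi * h * ((latticePoint N g n j : I) : ℝ)
        - 2 * Real.pi * h * ((latticePoint N g m j : I) : ℝ)
      = 2 * Real.pi * ((((n : ℕ) - (m : ℕ)) * (h * g j) : ℤ) : ℝ) / N
        - ((h * (⌊((n : ℕ) : ℝ) * g j / N⌋ - ⌊((m : ℕ) : ℝ) * g j / N⌋) : ℤ) : ℝ) *
          (2 * Real.pi) := by
    simp only [latticePoint, Int.fract]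
    push_cast
    ring
  rw [e2, Real.cos_sub_int_mul_two_pi]

theorem sum_fin_natCast_zmod (F : ZMod N → ℝ) :
    ∑ n : Fin N, F ((n : ℕ) : ZMod N) = ∑ n : ZMod N, F n := by
  refine Fintype.sum_bijective (fun n : Fin N => ((n : ℕ) : ZMod N)) ?_ _ _ fun _ => rfl
  rw [Fintype.bijective_iff_injective_and_card]
  refine ⟨fun a b hab => ?_, by simp [ZMod.card]⟩
  have := (ZMod.natCast_eq_natCast_iff' _ _ _).1 hab
  rw [Nat.mod_eq_of_lt a.2, Nat.mod_eq_of_lt b.2] at this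
  exact Fin.ext this

theorem sum_sum_korobovKernel_latticePoint {α : ℝ} (hα : 1 / 2 < α) {d : ℕ} {γ : Fin d → ℝ}
    (hγ : ∀ j, 0 < γ j) (g : Fin d → ℕ) :
    ∑ n : Fin N, ∑ m : Fin N, korobovKernel α γ (latticePoint N g n) (latticePoint N g m)
      = N ^ 2 * dualSum (foldedDecay N α γ) fun j => (g j : ZMod N) := by
  have h1 : ∀ n m : Fin N, korobovKernel α γ (latticePoint N g n) (latticePoint N g m)
      = ∏ j, ∑ v, foldedDecay N α γ j v *
        residueCos ((((n : ℕ) : ZMod N) - ((m : ℕ) : ZMod N)) * (v * (g j : ZMod N))) := by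
    intro n m
    refine Finset.prod_congr rfl fun j _ => ?_
    rw [(korobovKernel₁_eq hα (hγ j) _ _).2, foldedDecay,
      sum_residueMass_mul (summable_decay hα _) fun v =>
        residueCos ((((n : ℕ) : ZMod N) - ((m : ℕ) : ZMod N)) * (v * (g j : ZMod N)))]
    refine tsum_congr fun h => ?_
    rw [← Real.cos_sub, cos_sub_latticePoint]
  simp only [h1]
  rw [← sum_sum_prod_sum_residueCos_sub fun j v => foldedDecay_neg α γ j v,
    ← sum_fin_natCast_zmod]
  exact Finset.sum_congr rfl fun n _ => sum_fin_natCast_zmod fun m : ZMod N =>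
    ∏ j, ∑ v, foldedDecay N α γ j v *
      residueCos ((((n : ℕ) : ZMod N) - m) * (v * (g j : ZMod N)))

theorem sum_sum_korCosKernel_symLatticePoint {α : ℝ} (hα : 1 / 2 < α) {d : ℕ} {γ : Fin d → ℝ}
    (hγ : ∀ j, 0 < γ j) (g : Fin d → ℕ) :
    ∑ i, ∑ k, korCosKernel α γ (symLatticePoint N g i) (symLatticePoint N g k)
      = 4 ^ d * (N ^ 2 * symDualSum (foldedDecay N α fun j => symWeight α (γ j))
        fun j => (g j : ZMod N)) := by
  have h1 : ∀ n m : Fin N, ∏ j, ∑' h : ℤ, decay α (symWeight α (γ j)) h *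
      (Real.cos (2 * Real.pi * h * (latticePoint N g n j : I)) *
        Real.cos (2 * Real.pi * h * (latticePoint N g m j : I)))
      = ∏ j, ∑ v, foldedDecay N α (fun j => symWeight α (γ j)) j v *
        (residueCos (((n : ℕ) : ZMod N) * (v * (g j : ZMod N))) *
          residueCos (((m : ℕ) : ZMod N) * (v * (g j : ZMod N)))) := by
    intro n m
    refine Finset.prod_congr rfl fun j _ => ?_
    rw [foldedDecay, sum_residueMass_mul (summable_decay hα _) fun v =>
      residueCos (((n : ℕ) : ZMod N) * (v * (g j : ZMod N))) *
          residueCos (((m : ℕ) : ZMod N) * (v * (g j : ZMod N)))]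
    refine tsum_congr fun h => ?_
    rw [cos_latticePoint, cos_latticePoint]
  have h2 : ∑ i, ∑ k, korCosKernel α γ (symLatticePoint N g i) (symLatticePoint N g k)
      = ∑ n : Fin N, ∑ m : Fin N, ∑ u : Finset (Fin d), ∑ w : Finset (Fin d),
        korCosKernel α γ (symPoint u (latticePoint N g n)) (symPoint w (latticePoint N g m)) := by
    simp only [Fintype.sum_prod_type, symLatticePoint]
    exact Finset.sum_congr rfl fun n _ => Finset.sum_comm
  rw [h2]
  simp only [sum_sum_korCosKernel_symPoint hα hγ, h1, ← Finset.mul_sum]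
  rw [← sum_sum_prod_sum_residueCos_mul, ← sum_fin_natCast_zmod]
  congr 1
  exact Finset.sum_congr rfl fun n _ => sum_fin_natCast_zmod fun m : ZMod N =>
    ∏ j, ∑ v, foldedDecay N α (fun j => symWeight α (γ j)) j v *
        (residueCos (((n : ℕ) : ZMod N) * (v * (g j : ZMod N))) *
          residueCos (m * (v * (g j : ZMod N))))

variable {α : ℝ} {d : ℕ} {γ : Fin d → ℝ}

theorem worstCaseError_korobov_latticePoint [h : Fact (Admissible α γ)] (g : Fin d → ℕ) :
    worstCaseError (KorobovSpace α γ) (latticePoint N g) = ENNReal.ofReal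
      √(dualSum (foldedDecay N α γ) (fun j => (g j : ZMod N)) - 1) := by
  have hN : (N : ℝ) ≠ 0 := Nat.cast_ne_zero.2 (NeZero.ne N)
  rw [worstCaseError_korobovSpace,
    sum_sum_korobovKernel_latticePoint h.out.half_lt h.out.weight_pos, Fintype.card_fin]
  congr 2
  field_simp
  ring

theorem worstCaseError_korCos_symLatticePoint [h : Fact (Admissible α γ)] (g : Fin d → ℕ) :
    worstCaseError (KorCosSpace α γ) (symLatticePoint N g) = ENNReal.ofReal
      √(symDualSum (foldedDecay N α fun j => symWeight α (γ j)) (fun j => (g j : ZMod N)) - 1) := by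
  have hN : (N : ℝ) ≠ 0 := Nat.cast_ne_zero.2 (NeZero.ne N)
  have h4 : (4 : ℝ) ^ d = 2 ^ d * 2 ^ d := by rw [← mul_pow]; norm_num
  rw [worstCaseError_korCosSpace,
    sum_sum_korCosKernel_symLatticePoint h.out.half_lt h.out.weight_pos, Fintype.card_prod,
    Fintype.card_fin, Fintype.card_finset, Fintype.card_fin, h4]
  congr 2
  push_cast
  field_simp
  ring

end LatticeEvaluation

/-! ### Existence of component-by-component vectors -/

section CBCVector

/-- The component-by-component construction has an output for every error criterion. -/
theorem exists_isCBCVector {N : ℕ} (hN : 2 ≤ N) (s : ℕ)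
    (err : (d : ℕ) → d ≤ s → (Fin d → ℕ) → ℝ≥0∞) : ∃ g : Fin s → ℕ, IsCBCVector N s err g := by
  have key : ∀ k : ℕ, k ≤ s → ∃ g : Fin s → ℕ, (∀ j, g j ∈ Finset.Icc 1 (N - 1)) ∧
      ∀ (d : ℕ) (hd : d + 1 ≤ s), d < k → ∀ z ∈ Finset.Icc 1 (N - 1),
        err (d + 1) hd (fun i => g (Fin.castLE hd i)) ≤ err (d + 1) hd
          (Fin.snoc (α := fun _ => ℕ)
            (fun i : Fin d => g (Fin.castLE (Nat.le_of_succ_le hd) i)) z) := by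
    intro k
    induction k with
    | zero =>
      exact fun _ => ⟨fun _ => 1, fun _ => Finset.mem_Icc.2 ⟨le_rfl, Nat.le_sub_one_of_lt hN⟩,
        fun d _ hd => absurd hd (Nat.not_lt_zero d)⟩
    | succ k ih =>
      intro hk
      obtain ⟨g, hg, hmin⟩ := ih (Nat.le_of_succ_le hk)
      obtain ⟨z₀, hz₀, hle⟩ := Finset.exists_min_image (Finset.Icc 1 (N - 1))
        (fun z => err (k + 1) hk (Fin.snoc (α := fun _ => ℕ)
          (fun i : Fin k => g (Fin.castLE (Nat.le_of_succ_le hk) i)) z))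
        ⟨1, Finset.mem_Icc.2 ⟨le_rfl, by omega⟩⟩
      set g' : Fin s → ℕ := Function.update g ⟨k, hk⟩ z₀ with hg'
      have hold : ∀ (d : ℕ) (hd : d ≤ s), d ≤ k →
          (fun i : Fin d => g' (Fin.castLE hd i)) = fun i : Fin d => g (Fin.castLE hd i) := by
        intro d hd hdk
        funext i
        refine Function.update_of_ne (fun h => ?_) _ _
        have := congrArg Fin.val h
        simp only [Fin.val_castLE] at this
        omega
      refine ⟨g', fun j => ?_, fun d hd hdk z hz => ?_⟩
      · by_cases hj : j = ⟨k, hk⟩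
        · simpa [hg', hj] using hz₀
        · simpa [hg', hj] using hg j
      · rcases Nat.lt_succ_iff_lt_or_eq.1 hdk with hlt | rfl
        · rw [hold (d + 1) hd hlt, hold d _ hlt.le]
          exact hmin d hd hlt z hz
        · have hlast : g' (Fin.castLE hd (Fin.last d)) = z₀ := Function.update_self _ _ _
          rw [eq_snoc_castLE g' hd, hold d _ le_rfl, hlast]
          exact hle z hz
  obtain ⟨g, hg, hmin⟩ := key s le_rfl
  exact ⟨g, hg, fun d hd => hmin d hd hd⟩

end CBCVector

/-! ### The zeta value and the two forms of the constant -/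

section Constants

theorem realZeta_eq_tsum {t : ℝ} (ht : 1 < t) : realZeta t = ∑' k : ℕ+, (k : ℝ) ^ (-t) := by
  have h1 : riemannZeta (t : ℂ) = ((∑' n : ℕ, 1 / (n : ℝ) ^ t : ℝ) : ℂ) := by
    rw [zeta_eq_tsum_one_div_nat_cpow (by simpa using ht), Complex.ofReal_tsum]
    refine tsum_congr fun n => ?_
    rw [Complex.ofReal_div, Complex.ofReal_one, Complex.ofReal_cpow (Nat.cast_nonneg n),
      Complex.ofReal_natCast]
  rw [realZeta, h1, Complex.ofReal_re,
    ← tsum_pnat_eq_tsum_of_eq_zero (f := fun n : ℕ => 1 / (n : ℝ) ^ t)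
      (by simp [Real.zero_rpow (by linarith : t ≠ 0)])]
  refine tsum_congr fun k => ?_
  rw [Real.rpow_neg (by positivity), one_div]

theorem realZeta_pos {t : ℝ} (ht : 1 < t) : 0 < realZeta t := by
  rw [realZeta_eq_tsum ht]
  exact (summable_pnat_rpow_neg ht).tsum_pos (fun _ => by positivity) 1 (by simp)

theorem sum_nonempty_eq_prod_sub_one {s : ℕ} {γ : Fin s → ℝ} (hγ : ∀ j, 0 < γ j) (p b : ℝ) :
    ∑ u : Finset (Fin s) with u.Nonempty, (∏ j ∈ u, γ j) ^ p * b ^ u.card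
      = -1 + ∏ j, (1 + b * γ j ^ p) := by
  have h1 : ∀ u : Finset (Fin s), (∏ j ∈ u, γ j) ^ p * b ^ u.card = ∏ j ∈ u, b * γ j ^ p := by
    intro u
    rw [Finset.prod_mul_distrib, Finset.prod_const, Real.finsetProd_rpow _ _ fun j _ => (hγ j).le]
    ring
  have h2 : (Finset.univ.filter fun u : Finset (Fin s) => u.Nonempty) = Finset.univ.erase ∅ := by
    ext u
    simp [Finset.nonempty_iff_ne_empty]
  simp only [h1]
  rw [h2, Finset.prod_one_add, Finset.powerset_univ,
    ← Finset.add_sum_erase _ _ (Finset.mem_univ (∅ : Finset (Fin s))), Finset.prod_empty]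
  ring

theorem cbcConstant_eq (α : ℝ) {s : ℕ} {γ : Fin s → ℝ} (hγ : ∀ j, 0 < γ j) (τ : ℝ) :
    cbcConstant α γ τ
      = (-1 + ∏ j, (1 + 2 * realZeta (2 * α / τ) * γ j ^ (1 / τ))) ^ (τ / 2) := by
  rw [cbcConstant, sum_nonempty_eq_prod_sub_one hγ]

theorem cbcConstant_pos {α : ℝ} {s : ℕ} (hs : 1 ≤ s) {γ : Fin s → ℝ} (hγ : ∀ j, 0 < γ j) {τ : ℝ}
    (ht : 1 < 2 * α / τ) : 0 < cbcConstant α γ τ := by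
  have hz := realZeta_pos ht
  refine Real.rpow_pos_of_pos (Finset.sum_pos (fun u _ => ?_)
    ⟨{⟨0, hs⟩}, by simp⟩) _
  have := Finset.prod_pos fun j (_ : j ∈ u) => hγ j
  positivity

end Constants

/-! ### The error bound for both criteria -/

section ErrorBound

variable {N : ℕ}

theorem one_le_foldedDecay_zero {α : ℝ} (hα : 1 / 2 < α) {d : ℕ} {γ : Fin d → ℝ}
    (hγ : ∀ j, 0 < γ j) (j : Fin d) : 1 ≤ foldedDecay N α γ j 0 := by
  rw [foldedDecay, residueMass_decay hα, if_pos rfl]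
  exact le_add_of_nonneg_right (residueMass_nonneg (decayTail_nonneg α (hγ j)) 0)

theorem foldedDecay_mono {α : ℝ} (hα : 1 / 2 < α) {d : ℕ} {γ γ' : Fin d → ℝ}
    (h : ∀ j, γ j ≤ γ' j) (j : Fin d) (v : ZMod N) :
    foldedDecay N α γ j v ≤ foldedDecay N α γ' j v := by
  refine Summable.tsum_le_tsum (fun k => ?_) (summable_ite_residue (summable_decay hα _) v)
    (summable_ite_residue (summable_decay hα _) v)
  split_ifs
  · unfold decay
    split_ifs
    · exact le_rfl
    · exact mul_le_mul_of_nonneg_right (h j) (by positivity)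
  · exact le_rfl

theorem symDualSum_zero [NeZero N] (R : Fin 0 → ZMod N → ℝ) (g : Fin 0 → ZMod N) : symDualSum R g = 1 := by
  have hN : (N : ℝ) ≠ 0 := Nat.cast_ne_zero.2 (NeZero.ne N)
  simp [symDualSum, cosMean, ZMod.card, hN]

theorem dualSum_zero [NeZero N] (R : Fin 0 → ZMod N → ℝ) (g : Fin 0 → ZMod N) : dualSum R g = 1 := by
  simp [dualSum]

/-- The term `h = 0` alone is at least `1`. Hence the radicands of the errors are nonnegative, and
comparing errors is the same as comparing dual sums. -/
theorem one_le_symDualSum [NeZero N] {α : ℝ} (hα : 1 / 2 < α) {d : ℕ} {γ : Fin d → ℝ}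
    (hγ : ∀ j, 0 < γ j) (g : Fin d → ZMod N) : 1 ≤ symDualSum (foldedDecay N α γ) g := by
  have hN : (N : ℝ) ≠ 0 := Nat.cast_ne_zero.2 (NeZero.ne N)
  have h0 : cosMean g 0 = 1 := by simp [cosMean, residueCos_zero, ZMod.card, hN]
  have h1 := Finset.single_le_sum (f := fun h : Fin d → ZMod N =>
    (∏ j, foldedDecay N α γ j (h j)) * cosMean g h ^ 2) (fun h _ =>
      mul_nonneg (Finset.prod_nonneg fun j _ => foldedDecay_nonneg α hγ j _) (by positivity))
      (Finset.mem_univ 0)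
  refine le_trans ?_ h1
  simp only [h0, one_pow, mul_one, Pi.zero_apply]
  exact Finset.one_le_prod (fun j _ => one_le_foldedDecay_zero hα hγ j)

theorem one_le_dualSum [NeZero N] {α : ℝ} (hα : 1 / 2 < α) {d : ℕ} {γ : Fin d → ℝ}
    (hγ : ∀ j, 0 < γ j) (g : Fin d → ZMod N) : 1 ≤ dualSum (foldedDecay N α γ) g :=
  (one_le_symDualSum hα hγ g).trans
    (symDualSum_le_dualSum (foldedDecay_neg α γ) (foldedDecay_nonneg α hγ) g)

/-- The condition `1 ≤ b` rules out the truncation of the square root at negative arguments, which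
would lose the comparison. -/
theorem le_of_ofReal_sqrt_sub_one_le {a b : ℝ} (hb : 1 ≤ b)
    (h : ENNReal.ofReal √(a - 1) ≤ ENNReal.ofReal √(b - 1)) : a ≤ b := by
  rw [ENNReal.ofReal_le_ofReal_iff (Real.sqrt_nonneg _), Real.sqrt_le_sqrt_iff (by linarith)] at h
  linarith

theorem natCast_comp_snoc {d : ℕ} (g : Fin d → ℕ) (z : ℕ) :
    (fun j => ((Fin.snoc (α := fun _ => ℕ) g z j : ℕ) : ZMod N))
      = Fin.snoc (α := fun _ => ZMod N) (fun j => (g j : ZMod N)) (z : ZMod N) := by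
  funext j
  refine Fin.lastCases ?_ (fun i => ?_) j <;> simp

theorem val_mem_Icc [NeZero N] {z : ZMod N} (hz : z ≠ 0) : z.val ∈ Finset.Icc 1 (N - 1) := by
  have h1 := ZMod.val_lt z
  have h2 : z.val ≠ 0 := (ZMod.val_ne_zero z).2 hz
  exact Finset.mem_Icc.2 ⟨by omega, by omega⟩

theorem rpow_symDualSum_sub_one_le [NeZero N] (hN : 2 ≤ N) {α τ : ℝ} (hτ : 1 ≤ τ) (hτα : τ < 2 * α) {s : ℕ}
    {γ : Fin s → ℝ} [hadm : Fact (Admissible α γ)] {g : Fin s → ℕ}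
    (hg : IsCBCVector N s (korobovCriterion α γ N) g ∨
      IsCBCVector N s (korCosCriterion α γ N) g) :
    (symDualSum (foldedDecay N α fun j => symWeight α (γ j)) (fun j => (g j : ZMod N)) - 1)
        ^ (1 / τ)
      ≤ (-1 + ∏ j, (1 + 2 * (∑' k : ℕ+, (k : ℝ) ^ (-(2 * α / τ))) * γ j ^ (1 / τ))) / (N - 1) := by
  have hτ0 : 0 < τ := by linarith
  have hp : 0 < 1 / τ := by positivity
  have hα : 1 / 2 < α := hadm.out.half_lt
  have hγ := hadm.out.weight_pos
  have hγs : ∀ j, 0 < symWeight α (γ j) := fun j => symWeight_pos α (hγ j)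
  have hN1 : (0 : ℝ) ≤ N - 1 := by
    have : (2 : ℝ) ≤ N := by exact_mod_cast hN
    linarith
  have hone := one_le_symDualSum (N := N) hα hγs fun j => (g j : ZMod N)
  rcases hg with ⟨-, hg⟩ | ⟨-, hg⟩
  -- Korobov criterion: the bound holds for `dualSum` with weights `γ`, which dominates `symDualSum`
  -- with the smaller weights `symWeight α γ`.
  · have h1 := (dual_bound_of_minimizer (α := α) hN hτ hτα (D := fun _ => dualSum) dualSum_zero
      (fun _ R g hR => dualSum_nonneg hR g) (fun _ R g _ _ => le_rfl)
      (fun _ R ρ g z => dualSum_snoc_add_ite R ρ g z) hγ (fun j => (g j : ZMod N))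
      (fun d hd z hz => by
        have h := hg d hd z.val (val_mem_Icc hz)
        simp only [korobovCriterion, worstCaseError_korobov_latticePoint] at h
        have h' := le_of_ofReal_sqrt_sub_one_le
          (one_le_dualSum hα (fun j => hγ (Fin.castLE hd j)) _) h
        rwa [natCast_comp_snoc, ZMod.natCast_zmod_val] at h') s le_rfl).2
    refine (Real.rpow_le_rpow (by linarith) (sub_le_sub_right ?_ 1) hp.le).trans h1
    exact (symDualSum_le_dualSum (foldedDecay_neg α _) (foldedDecay_nonneg α hγs) _).trans
      (dualSum_mono (foldedDecay_nonneg α hγs)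
        (foldedDecay_mono hα fun j => symWeight_le hα (hγ j)) _)
  -- Symmetrized criterion: the induction runs directly on `symDualSum` with weights `symWeight α
  -- γ`, and these are replaced by `γ` only in the final product.
  · have h1 := (dual_bound_of_minimizer (α := α) hN hτ hτα (D := fun _ => symDualSum)
      symDualSum_zero (fun _ R g hR => symDualSum_nonneg hR g)
      (fun _ R g hRe hR => symDualSum_le_dualSum hRe hR g)
      (fun _ R ρ g z => symDualSum_snoc_add_ite R ρ g z) hγs (fun j => (g j : ZMod N))
      (fun d hd z hz => by
        have h := hg d hd z.val (val_mem_Icc hz)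
        simp only [korCosCriterion, worstCaseError_korCos_symLatticePoint] at h
        have h' := le_of_ofReal_sqrt_sub_one_le
          (one_le_symDualSum hα (fun j => hγs (Fin.castLE hd j)) _) h
        rwa [natCast_comp_snoc, ZMod.natCast_zmod_val] at h') s le_rfl).2
    refine h1.trans (div_le_div_of_nonneg_right (add_le_add_right ?_ _) hN1)
    have hZ : 0 ≤ ∑' k : ℕ+, (k : ℝ) ^ (-(2 * α / τ)) := tsum_nonneg fun _ => by positivity
    refine Finset.prod_le_prod (fun j _ => ?_) fun j _ => ?_
    · have := Real.rpow_nonneg (hγs j).le (1 / τ)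
      positivity
    · have := Real.rpow_le_rpow (hγs j).le (symWeight_le hα (hγ j)) hp.le
      exact add_le_add_right (mul_le_mul_of_nonneg_left this (by positivity)) 1

theorem worstCaseError_korCos_le [NeZero N] (hN : 2 ≤ N) {α τ : ℝ} (hτ : 1 ≤ τ) (hτα : τ < 2 * α) {s : ℕ}
    {γ : Fin s → ℝ} [hadm : Fact (Admissible α γ)] {g : Fin s → ℕ}
    (hg : IsCBCVector N s (korobovCriterion α γ N) g ∨
      IsCBCVector N s (korCosCriterion α γ N) g) :
    worstCaseError (KorCosSpace α γ) (symLatticePoint N g)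
      ≤ ENNReal.ofReal (cbcConstant α γ τ * ((N : ℝ) - 1) ^ (-τ / 2)) := by
  have hτ0 : 0 < τ := by linarith
  have ht : 1 < 2 * α / τ := by rw [lt_div_iff₀ hτ0]; linarith
  have hγ := hadm.out.weight_pos
  have hN1 : (0 : ℝ) < N - 1 := by
    have : (2 : ℝ) ≤ N := by exact_mod_cast hN
    linarith
  have hX := one_le_symDualSum (N := N) hadm.out.half_lt (fun j => symWeight_pos α (hγ j))
    fun j => (g j : ZMod N)
  have hle := rpow_symDualSum_sub_one_le hN hτ hτα hg
  rw [worstCaseError_korCos_symLatticePoint, cbcConstant_eq α hγ, realZeta_eq_tsum ht]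
  refine ENNReal.ofReal_le_ofReal ?_
  set X := symDualSum (foldedDecay N α fun j => symWeight α (γ j)) (fun j => (g j : ZMod N)) - 1
    with hXdef
  set P := -1 + ∏ j, (1 + 2 * (∑' k : ℕ+, (k : ℝ) ^ (-(2 * α / τ))) * γ j ^ (1 / τ)) with hP
  have hX0 : 0 ≤ X := by linarith
  have hP0 : 0 ≤ P := by
    have h0 : 0 ≤ P / (N - 1) := (Real.rpow_nonneg hX0 _).trans hle
    rwa [le_div_iff₀ hN1, zero_mul] at h0
  -- The exponents combine to `(1/τ)(τ/2) = 1/2`, matching the square root in the error.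
  calc √X = (X ^ (1 / τ)) ^ (τ / 2) := by
        rw [Real.sqrt_eq_rpow, ← Real.rpow_mul hX0]
        congr 1
        field_simp
    _ ≤ (P / (N - 1)) ^ (τ / 2) :=
        Real.rpow_le_rpow (Real.rpow_nonneg hX0 _) hle (by positivity)
    _ = P ^ (τ / 2) * ((N : ℝ) - 1) ^ (-τ / 2) := by
        rw [Real.div_rpow hP0 hN1.le, neg_div, Real.rpow_neg hN1.le, div_eq_mul_inv]

end ErrorBound

end LatticeCubature

end

theorem mainTheorem9 (α : ℝ) (s : ℕ) (hs : 1 ≤ s) (γ : Fin s → ℝ)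
    [hadm : Fact (LatticeCubature.Admissible α γ)] (N : ℕ) (hN : 2 ≤ N) :
    -- the functions of the space are integrable, so that the worst-case error is meaningful
    (∀ f : LatticeCubature.KorCosSpace α γ,
      MeasureTheory.Integrable (fun x : Fin s → unitInterval => f x)) ∧
    -- the component-by-component construction has an output, with either error criterion
    (∃ g : Fin s → ℕ,
      LatticeCubature.IsCBCVector N s (LatticeCubature.korobovCriterion α γ N) g) ∧
    (∃ g : Fin s → ℕ,
      LatticeCubature.IsCBCVector N s (LatticeCubature.korCosCriterion α γ N) g) ∧
    -- each output satisfies the error bound, for all admissible `τ` at once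
    (∀ g : Fin s → ℕ,
      (LatticeCubature.IsCBCVector N s (LatticeCubature.korobovCriterion α γ N) g ∨
        LatticeCubature.IsCBCVector N s (LatticeCubature.korCosCriterion α γ N) g) →
      ∀ τ : ℝ, 1 ≤ τ → τ < 2 * α →
        LatticeCubature.worstCaseError (LatticeCubature.KorCosSpace α γ)
            (LatticeCubature.symLatticePoint N g) ≤
          ENNReal.ofReal (LatticeCubature.cbcConstant α γ τ * ((N : ℝ) - 1) ^ (-τ / 2))) ∧
    -- the constant is positive and has the product form
    (∀ τ : ℝ, 1 ≤ τ → τ < 2 * α →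
      0 < LatticeCubature.cbcConstant α γ τ ∧
      LatticeCubature.cbcConstant α γ τ =
        (-1 + ∏ j, (1 + 2 * LatticeCubature.realZeta (2 * α / τ) * γ j ^ (1 / τ))) ^ (τ / 2)) := by
  have : NeZero N := ⟨by omega⟩
  have hα := hadm.out.half_lt
  have hγ := hadm.out.weight_pos
  refine ⟨LatticeCubature.integrable_coe RKHS.OfKernel.kernel_ofKernel
      (LatticeCubature.continuous_korCosKernel hα hγ),
    LatticeCubature.exists_isCBCVector hN s _, LatticeCubature.exists_isCBCVector hN s _,
    fun g hg τ hτ hτα => LatticeCubature.worstCaseError_korCos_le hN hτ hτα hg,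
    fun τ hτ hτα => ⟨LatticeCubature.cbcConstant_pos hs hγ ?_,
      LatticeCubature.cbcConstant_eq α hγ τ⟩⟩
  rw [lt_div_iff₀ (by linarith)]
  linarith
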